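/- **Setting.** Let $P$ be a subsemigroup, containing the identity $e$, of a group $G$, with $P\cap P^{-1}=\{e\}$, and write $s\le t$ when $s^{-1}t\in P$. Suppose that $(G,P)$ is quasi-lattice ordered: every finite subset of $G$ with an upper bound in $P$ has a least upper bound in $P$. For $s,t\in P$ write $s\vee t$ for their least upper bound in $P$, and $s\vee t=\infty$ if there is none. A *product system* $E$ over $P$ is a family $(E_t)_{t\in P}$ of nonzero complex Hilbert spaces with $\dim E_e=1$, together with an associative multiplication on $E=\bigsqcup_t E_t$ that maps $E_s\times E_t$ into $E_{st}$ and, for all $s,t$, extends to a unitary isomorphism of $E_s\otimes E_t$ onto $E_{st}$. A *representation* of $E$ in a unital $C^*$-algebra is a multiplicative map $\phi$ with $\phi(v)^*\phi(u)=\langle u,v\rangle 1$ for $u,v$ in the same fibre. If $\phi$ is a representation on a Hilbert space $\mathcal H$ (that is, in $B(\mathcal H)$), then $\alpha^\phi_t(T)=\sum_{u}\phi(u)T\phi(u)^*$ for $T\in B(\mathcal H)$, a strongly convergent sum over any orthonormal basis of $E_t$. The representation $\phi$ is *covariant* if $\alpha^\phi_s(I)\alpha^\phi_t(I)$ equals $\alpha^\phi_{s\vee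 t}(I)$ when $s\vee t<\infty$ and $0$ when $s\vee t=\infty$, for all $s,t\in P$. Let $B_P\subset\ell^\infty(P)$ be the closed span of the functions $1_t=\chi_{\{s\in P:\,s\ge t\}}$, a unital $C^*$-algebra, and let $\tau$ be the action of $P$ on $B_P$ by left translation, so that $\tau_s(1_t)=1_{st}$. A *covariant representation* of $(B_P,P,\tau,E)$ is a pair $(\pi,\phi)$ of a unital representation of $B_P$ and a representation of $E$ on the same Hilbert space with $\pi\circ\tau_s=\alpha^\phi_s\circ\pi$ for all $s\in P$. A *crossed product* of the system is a unital $C^*$-algebra $B=B_P\rtimes_{\tau,E}P$ with a unital $*$-homomorphism $i_{B_P}:B_P\to B$ and a representation $i_E:E\to B$ such that: some faithful unital representation $\sigma$ of $B$ on a Hilbert space makes $(\sigma\circ i_{B_P},\sigma\circ i_E)$ covariant; for every covariant representation $(\pi,\phi)$ there is a unital representation $\rho$ of $B$ with $\rho\circ i_{B_P}=\pi$ and $\rho\circ i_E=\phi$; and $B$ is generated as a $C^*$-algebra by $i_{B_P}(B_P)\cup i_E(E)$. **Theorem.** Let $(G,P)$ be a quasi-lattice ordered group and $E$ a product system over $P$.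 The system $(B_P,P,\tau,E)$ has a crossed product. For every crossed product $(B_P\rtimes_{\tau,E}P,\,i_{B_P},\,i_E)$, the $C^*$-subalgebra $A$ generated by $i_E(E)$ is universal for covariant representations of $E$, in the sense that (a) there is a faithful unital representation $\sigma$ of $A$ on a Hilbert space such that $\sigma\circ i_E$ is a covariant representation of $E$; and (b) for every covariant representation $\phi$ of $E$ on a Hilbert space there is a unital representation $\pi$ of $A$ with $\phi=\pi\circ i_E$. If moreover every fibre $E_t$ is finite-dimensional, then $A=B_P\rtimes_{\tau,E}P$ and $$B_P\rtimes_{\tau,E}P=\overline{\operatorname{span}}\{\,i_E(u)i_E(v)^*:u,v\in E\,\}.$$ -/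

import Mathlib

open scoped ENNReal TensorProduct

universe u v w x

/-! ### Quasi-lattice ordered groups -/

/-- For a submonoid `P` of a group, `s ≤ t` means `s⁻¹ * t ∈ P`. -/
def PLe {G : Type u} [Group G] (P : Submonoid G) (s t : G) : Prop := s⁻¹ * t ∈ P

/-- `m` is an upper bound in `P` of `F`, for the order `PLe P`. -/
def IsUpperBoundIn {G : Type u} [Group G] (P : Submonoid G) (F : Set G) (m : G) : Prop :=
  m ∈ P ∧ ∀ x ∈ F, PLe P x m

/-- `m` is the least upper bound in `P` of `F`. -/
def IsLeastUpperBoundIn {G : Type u} [Group G] (P : Submonoid G) (F : Set G) (m : G) : Prop :=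
  IsUpperBoundIn P F m ∧ ∀ m', IsUpperBoundIn P F m' → PLe P m m'

/-- `(G, P)` is quasi-lattice ordered: `P ∩ P⁻¹ = {e}`, and every finite subset of `G` which has
an upper bound in `P` has a least upper bound in `P`. -/
structure IsQuasiLatticeOrdered {G : Type u} [Group G] (P : Submonoid G) : Prop where
  eq_one_of_mem_of_inv_mem : ∀ g : G, g ∈ P → g⁻¹ ∈ P → g = 1
  exists_lub : ∀ F : Finset G, (∃ m, IsUpperBoundIn P (F : Set G) m) →
    ∃ m, IsLeastUpperBoundIn P (F : Set G) m

/-! ### Product systems -/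

/-- A (discrete) product system over a monoid `P`: a family of nontrivial complex Hilbert spaces
`fibre t`, one-dimensional over the identity, whose disjoint union carries an associative
multiplication over that of `P` such that `(u, v) ↦ u v` extends to a unitary isomorphism of the
Hilbert space tensor product (the completion of the algebraic one) of `fibre s` and `fibre t` onto
`fibre (s * t)`. -/
structure ProductSystem (P : Type u) [Monoid P] where
  fibre : P → Type v
  [normed : ∀ t, NormedAddCommGroup (fibre t)]
  [innerProduct : ∀ t, InnerProductSpace ℂ (fibre t)]
  [complete : ∀ t, CompleteSpace (fibre t)]
  [nontrivial : ∀ t, Nontrivial (fibre t)]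
  finrank_fibre_one : Module.finrank ℂ (fibre 1) = 1
  mul : ∀ {s t : P}, fibre s → fibre t → fibre (s * t)
  mul_assoc' : ∀ {r s t : P} (x : fibre r) (y : fibre s) (z : fibre t),
    (⟨r * s * t, mul (mul x y) z⟩ : Σ p, fibre p) = ⟨r * (s * t), mul x (mul y z)⟩
  exists_unitary : ∀ s t : P,
    ∃ U : UniformSpace.Completion (fibre s ⊗[ℂ] fibre t) ≃ₗᵢ[ℂ] fibre (s * t),
      ∀ (x : fibre s) (y : fibre t),
        U ((x ⊗ₜ[ℂ] y : fibre s ⊗[ℂ] fibre t) :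
          UniformSpace.Completion (fibre s ⊗[ℂ] fibre t)) = mul x y

namespace ProductSystem

attribute [instance] ProductSystem.normed ProductSystem.innerProduct ProductSystem.complete
  ProductSystem.nontrivial

variable {P : Type u} [Monoid P]

/-- The total space of a product system, a semigroup. -/
def Total (E : ProductSystem.{u, v} P) : Type (max u v) := Σ t, E.fibre t

instance (E : ProductSystem.{u, v} P) : Semigroup E.Total where
  mul x y := ⟨x.1 * y.1, E.mul x.2 y.2⟩
  mul_assoc x y z := E.mul_assoc' x.2 y.2 z.2

/-- The inclusion of a fibre in the total space. -/
def incl (E : ProductSystem.{u, v} P) {t : P} (x : E.fibre t) : E.Total := ⟨t, x⟩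

end ProductSystem

/-- A representation of a product system in a unital `*`-algebra `B`: a multiplicative map `φ` with
`φ(v)^* φ(u) = ⟨u, v⟩ 1` whenever `u` and `v` lie in the same fibre, for the inner product that is
linear in `u` (Mathlib's `inner ℂ v u`).  Representations on a Hilbert space `H` are the case
`B = H →L[ℂ] H`. -/
structure ProductSystem.Rep {P : Type u} [Monoid P] (E : ProductSystem.{u, v} P) (B : Type w)
    [Ring B] [StarRing B] [Algebra ℂ B] where
  toFun : E.Total → B
  map_mul' : ∀ x y : E.Total, toFun (x * y) = toFun x * toFun y
  star_mul' : ∀ {t : P} (x y : E.fibre t),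
    star (toFun (E.incl y)) * toFun (E.incl x) = inner ℂ y x • (1 : B)

namespace ProductSystem.Rep

variable {P : Type u} [Monoid P] {E : ProductSystem.{u, v} P}

instance {B : Type w} [Ring B] [StarRing B] [Algebra ℂ B] :
    CoeFun (E.Rep B) (fun _ => E.Total → B) := ⟨toFun⟩

/-- The composition `σ ∘ φ` of a representation with a unital `*`-homomorphism. -/
def comp {B : Type w} [Ring B] [StarRing B] [Algebra ℂ B] {C : Type*} [Ring C] [StarRing C]
    [Algebra ℂ C] (σ : B →⋆ₐ[ℂ] C) (φ : E.Rep B) : E.Rep C where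
  toFun x := σ (φ x)
  map_mul' x y := by rw [φ.map_mul', map_mul]
  star_mul' x y := by rw [← map_star, ← map_mul, φ.star_mul', map_smul, map_one]

/-- The corestriction of a representation to a `*`-subalgebra containing its range. -/
def codRestrict {B : Type w} [Ring B] [StarRing B] [Algebra ℂ B] [StarModule ℂ B]
    (φ : E.Rep B) (A : StarSubalgebra ℂ B) (h : ∀ x, φ x ∈ A) : E.Rep A where
  toFun x := ⟨φ x, h x⟩
  map_mul' x y := Subtype.ext (φ.map_mul' x y)
  star_mul' x y := Subtype.ext (φ.star_mul' x y)

/-! ### The endomorphisms `α_t` -/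

section alpha

variable {H : Type w} [NormedAddCommGroup H] [InnerProductSpace ℂ H] [CompleteSpace H]

theorem map_linear (φ : E.Rep (H →L[ℂ] H)) {t : P} (c : ℂ) (x y : E.fibre t) :
    φ (E.incl (c • x + y)) = c • φ (E.incl x) + φ (E.incl y) := by
  rw [← sub_eq_zero, ← CStarRing.star_mul_self_eq_zero_iff]
  simp only [star_sub, star_add, star_smul, sub_mul, mul_sub, add_mul, mul_add,
    smul_mul_assoc, mul_smul_comm, φ.star_mul', inner_add_left, inner_add_right, inner_smul_left,
    inner_smul_right, smul_smul, add_smul, starRingEnd_apply, smul_add]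
  module

theorem inner_apply (φ : E.Rep (H →L[ℂ] H)) {t : P} (x y : E.fibre t) (h k : H) :
    inner ℂ (φ (E.incl y) k) (φ (E.incl x) h) = inner ℂ y x * inner ℂ k h := by
  rw [← ContinuousLinearMap.adjoint_inner_right, ← ContinuousLinearMap.star_eq_adjoint,
    ← mul_apply_eq_comp, φ.star_mul', smul_apply,
    one_apply_eq_self, inner_smul_right]

theorem norm_apply (φ : E.Rep (H →L[ℂ] H)) {t : P} (x : E.fibre t) (h : H) :
    ‖φ (E.incl x) h‖ = ‖x‖ * ‖h‖ := by
  have h1 := φ.inner_apply x x h h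
  simp only [inner_self_eq_norm_sq_to_K] at h1
  have h2 : ‖φ (E.incl x) h‖ ^ 2 = (‖x‖ * ‖h‖) ^ 2 := by
    rw [mul_pow]; exact_mod_cast h1
  exact (sq_eq_sq₀ (norm_nonneg _) (by positivity)).1 h2

/-- `u ↦ φ(u) h` on a fibre, as a bounded operator. -/
noncomputable def applyCLM (φ : E.Rep (H →L[ℂ] H)) (t : P) (h : H) : E.fibre t →L[ℂ] H :=
  LinearMap.mkContinuous
    { toFun := fun x => φ (E.incl x) h
      map_add' := fun x y => by simpa using congrArg (fun T : H →L[ℂ] H => T h) (φ.map_linear 1 x y)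
      map_smul' := fun c x => by
        have h0 : φ (E.incl (0 : E.fibre t)) h = 0 := by
          rw [← norm_eq_zero, norm_apply]; simp
        simpa [h0] using congrArg (fun T : H →L[ℂ] H => T h) (φ.map_linear c x 0) }
    ‖h‖ (fun x => by simp [norm_apply, mul_comm])

theorem applyCLM_apply (φ : E.Rep (H →L[ℂ] H)) (t : P) (h : H) (x : E.fibre t) :
    φ.applyCLM t h x = φ (E.incl x) h := rfl

/-- For a unit vector `x`, `φ(x)` is an isometry. -/
noncomputable def isometry (φ : E.Rep (H →L[ℂ] H)) {t : P} (x : E.fibre t) (hx : ‖x‖ = 1) :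
    H →ₗᵢ[ℂ] H where
  toLinearMap := (φ (E.incl x)).toLinearMap
  norm_map' h := by simpa [hx] using φ.norm_apply x h

theorem orthogonalFamily (φ : E.Rep (H →L[ℂ] H)) {t : P} {ι : Type*} (b : HilbertBasis ι ℂ (E.fibre t)) :
    OrthogonalFamily ℂ (fun _ : ι => H) (fun i => φ.isometry (b i) (b.orthonormal.1 i)) := by
  intro i j hij h k
  refine (φ.inner_apply (b j) (b i) k h).trans ?_
  rw [b.orthonormal.2 hij, zero_mul]

theorem sum_norm_sq_le (φ : E.Rep (H →L[ℂ] H)) {t : P} {ι : Type*}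
    (b : HilbertBasis ι ℂ (E.fibre t)) (x : H) (s : Finset ι) :
    ∑ i ∈ s, ‖star (φ (E.incl (b i))) x‖ ^ 2 ≤ ‖x‖ ^ 2 := by
  have h1 := (φ.orthogonalFamily b).norm_sum (fun i => star (φ (E.incl (b i))) x) s
  set y := ∑ i ∈ s, (φ.isometry (b i) (b.orthonormal.1 i)) (star (φ (E.incl (b i))) x) with hy
  have h2 : inner ℂ y x = ((‖y‖ ^ 2 : ℝ) : ℂ) := by
    rw [h1, hy, sum_inner]
    push_cast
    refine Finset.sum_congr rfl fun i _ => ?_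
    refine Eq.trans ?_ (inner_self_eq_norm_sq_to_K (𝕜 := ℂ) (star (φ (E.incl (b i))) x))
    exact (ContinuousLinearMap.adjoint_inner_right (φ (E.incl (b i)))
      (star (φ (E.incl (b i))) x) x).symm
  have h3 : ‖y‖ ^ 2 ≤ ‖y‖ * ‖x‖ := by
    have := norm_inner_le_norm (𝕜 := ℂ) y x
    rw [h2] at this
    simpa using this
  rw [← h1]
  have h4 : ‖y‖ ≤ ‖x‖ := by
    by_contra hlt
    push Not at hlt
    nlinarith [norm_nonneg x, norm_nonneg y]
  gcongr

theorem sum_norm_le (φ : E.Rep (H →L[ℂ] H)) {t : P} {ι : Type*}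
    (b : HilbertBasis ι ℂ (E.fibre t)) (A : H →L[ℂ] H) (x : H) (s : Finset ι) :
    ‖∑ i ∈ s, (φ (E.incl (b i)) * A * star (φ (E.incl (b i)))) x‖ ≤ ‖A‖ * ‖x‖ := by
  have h1 := (φ.orthogonalFamily b).norm_sum (fun i => A (star (φ (E.incl (b i))) x)) s
  refine (sq_le_sq₀ (norm_nonneg _) (by positivity)).1 ?_
  refine le_trans (le_of_eq h1) ?_
  calc ∑ i ∈ s, ‖A (star (φ (E.incl (b i))) x)‖ ^ 2
      ≤ ∑ i ∈ s, ‖A‖ ^ 2 * ‖star (φ (E.incl (b i))) x‖ ^ 2 := by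
        refine Finset.sum_le_sum fun i _ => ?_
        rw [← mul_pow]
        exact pow_le_pow_left₀ (norm_nonneg _) (A.le_opNorm _) 2
    _ ≤ (‖A‖ * ‖x‖) ^ 2 := by
        rw [← Finset.mul_sum, mul_pow]
        exact mul_le_mul_of_nonneg_left (φ.sum_norm_sq_le b x s) (by positivity)

theorem summable_alpha (φ : E.Rep (H →L[ℂ] H)) {t : P} {ι : Type*}
    (b : HilbertBasis ι ℂ (E.fibre t)) (A : H →L[ℂ] H) (x : H) :
    Summable fun i => (φ (E.incl (b i)) * A * star (φ (E.incl (b i)))) x := by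
  refine ((φ.orthogonalFamily b).summable_iff_norm_sq_summable
    (fun i => A (star (φ (E.incl (b i))) x))).2 ?_
  have h1 : Summable fun i => ‖star (φ (E.incl (b i))) x‖ ^ 2 :=
    summable_of_sum_le (fun i => by positivity) (φ.sum_norm_sq_le b x)
  refine Summable.of_nonneg_of_le (fun i => by positivity) (fun i => ?_) (h1.mul_left (‖A‖ ^ 2))
  rw [← mul_pow]
  exact pow_le_pow_left₀ (norm_nonneg _) (A.le_opNorm _) 2

/-- The strongly convergent sum `∑ φ(u) A φ(u)^*`, over an orthonormal basis of a fibre. -/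
noncomputable def basisSum (φ : E.Rep (H →L[ℂ] H)) {t : P} {ι : Type*}
    (b : HilbertBasis ι ℂ (E.fibre t)) (A : H →L[ℂ] H) : H →L[ℂ] H :=
  LinearMap.mkContinuous
    { toFun := fun x => ∑' i, (φ (E.incl (b i)) * A * star (φ (E.incl (b i)))) x
      map_add' := fun x y => by
        simp only [map_add]
        exact (φ.summable_alpha b A x).tsum_add (φ.summable_alpha b A y)
      map_smul' := fun c x => by
        simp only [map_smul]
        exact (φ.summable_alpha b A x).tsum_const_smul c }
    ‖A‖ (fun x => le_of_tendsto (φ.summable_alpha b A x).hasSum.norm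
      (Filter.Eventually.of_forall (φ.sum_norm_le b A x)))

theorem hasSum_basisSum (φ : E.Rep (H →L[ℂ] H)) {t : P} {ι : Type*}
    (b : HilbertBasis ι ℂ (E.fibre t)) (A : H →L[ℂ] H) (x : H) :
    HasSum (fun i => (φ (E.incl (b i)) * A * star (φ (E.incl (b i)))) x) (φ.basisSum b A x) :=
  (φ.summable_alpha b A x).hasSum

/-- The endomorphism `α^φ_t` of `B(H)`: `α^φ_t(A) = ∑ φ(u) A φ(u)^*`, a strongly convergent sum
over an orthonormal basis of the fibre over `t`.  It does not depend on the choice of the basis, by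
`hasSum_alpha` below. -/
noncomputable def alpha (φ : E.Rep (H →L[ℂ] H)) (t : P) (A : H →L[ℂ] H) : H →L[ℂ] H :=
  φ.basisSum (exists_hilbertBasis ℂ (E.fibre t)).choose_spec.choose A

theorem basisSum_mul (φ : E.Rep (H →L[ℂ] H)) {t : P} {ι : Type*}
    (b : HilbertBasis ι ℂ (E.fibre t)) (A : H →L[ℂ] H) (u : E.fibre t) (h : H) :
    φ.basisSum b A (φ (E.incl u) h) = φ (E.incl u) (A h) := by
  refine (φ.hasSum_basisSum b A _).unique ?_
  have h1 := (b.hasSum_repr u).mapL (φ.applyCLM t (A h))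
  rw [applyCLM_apply] at h1
  convert h1 using 2 with i
  have h2 : star (φ (E.incl (b i))) (φ (E.incl u) h) = inner ℂ (b i) u • h := by
    rw [← mul_apply_eq_comp, φ.star_mul', smul_apply,
      one_apply_eq_self]
  rw [mul_apply_eq_comp, mul_apply_eq_comp, h2, map_smul, map_smul,
    map_smul, applyCLM_apply, b.repr_apply_apply]

theorem basisSum_eq_zero (φ : E.Rep (H →L[ℂ] H)) {t : P} {ι : Type*}
    (b : HilbertBasis ι ℂ (E.fibre t)) (A : H →L[ℂ] H) (x : H)
    (hx : ∀ u : E.fibre t, star (φ (E.incl u)) x = 0) : φ.basisSum b A x = 0 := by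
  refine (φ.hasSum_basisSum b A x).unique ?_
  simp [mul_apply_eq_comp, hx]

theorem star_basisSum_one (φ : E.Rep (H →L[ℂ] H)) {t : P} {ι : Type*}
    (b : HilbertBasis ι ℂ (E.fibre t)) (x : H) (u : E.fibre t) :
    star (φ (E.incl u)) (x - φ.basisSum b 1 x) = 0 := by
  have h1 : ∀ i, star (φ (E.incl (b i))) (x - φ.basisSum b 1 x) = 0 := by
    intro i
    rw [map_sub, sub_eq_zero]
    classical
    refine HasSum.unique ?_ ((φ.hasSum_basisSum b 1 x).mapL (star (φ (E.incl (b i)))))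
    convert hasSum_ite_eq i (star (φ (E.incl (b i))) x) using 2 with j
    rw [mul_one, mul_apply_eq_comp, ← mul_apply_eq_comp, φ.star_mul',
      smul_apply, one_apply_eq_self]
    split_ifs with hij
    · subst hij
      simp [inner_self_eq_norm_sq_to_K, b.orthonormal.1]
    · rw [b.orthonormal.2 (Ne.symm hij), zero_smul]
  refine ext_inner_right ℂ fun k => ?_
  rw [inner_zero_left, ContinuousLinearMap.star_eq_adjoint, ContinuousLinearMap.adjoint_inner_left]
  have h2 := ((b.hasSum_repr u).mapL (φ.applyCLM t k)).mapL
    (innerSL ℂ (x - φ.basisSum b 1 x))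
  have h3 : ∀ i, innerSL ℂ (x - φ.basisSum b 1 x)
      (φ.applyCLM t k (b.repr u i • b i)) = 0 := by
    intro i
    rw [map_smul, map_smul, innerSL_apply_apply, applyCLM_apply,
      ← ContinuousLinearMap.adjoint_inner_left, ← ContinuousLinearMap.star_eq_adjoint, h1,
      inner_zero_left, smul_zero]
  simp only [h3] at h2
  exact h2.unique hasSum_zero

theorem basisSum_eq (φ : E.Rep (H →L[ℂ] H)) {t : P} {ι ι' : Type*}
    (b : HilbertBasis ι ℂ (E.fibre t)) (b' : HilbertBasis ι' ℂ (E.fibre t)) (A : H →L[ℂ] H) :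
    φ.basisSum b A = φ.basisSum b' A := by
  ext x
  have h1 : φ.basisSum b A (φ.basisSum b 1 x) = φ.basisSum b' A (φ.basisSum b 1 x) := by
    have h2 := (φ.hasSum_basisSum b 1 x).mapL (φ.basisSum b A)
    have h3 := (φ.hasSum_basisSum b 1 x).mapL (φ.basisSum b' A)
    refine h2.unique ?_
    convert h3 using 2 with i
    rw [mul_apply_eq_comp, mul_apply_eq_comp, basisSum_mul, basisSum_mul]
  have h2 := φ.basisSum_eq_zero b A _ (φ.star_basisSum_one b x)
  have h3 := φ.basisSum_eq_zero b' A _ (φ.star_basisSum_one b x)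
  rw [map_sub, sub_eq_zero] at h2 h3
  rw [h2, h3, h1]

/-- `α^φ_t(A)` is the strong sum `∑ φ(u) A φ(u)^*` over every orthonormal basis of the fibre. -/
theorem hasSum_alpha (φ : E.Rep (H →L[ℂ] H)) {t : P} {ι : Type*}
    (b : HilbertBasis ι ℂ (E.fibre t)) (A : H →L[ℂ] H) (x : H) :
    HasSum (fun i => (φ (E.incl (b i)) * A * star (φ (E.incl (b i)))) x) (φ.alpha t A x) := by
  rw [alpha, basisSum_eq φ _ b]
  exact φ.hasSum_basisSum b A x

end alpha

end ProductSystem.Rep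

/-- A representation `φ` of a product system over a quasi-lattice ordered `P` is covariant if
`α^φ_s(I) α^φ_t(I)` is `α^φ_{s ∨ t}(I)` when `s` and `t` have a least upper bound `s ∨ t` in `P`,
and is `0` when they have none. -/
def ProductSystem.Rep.IsCovariant {G : Type u} [Group G] {P : Submonoid G}
    {E : ProductSystem.{u, v} P} {H : Type w} [NormedAddCommGroup H] [InnerProductSpace ℂ H]
    [CompleteSpace H] (φ : E.Rep (H →L[ℂ] H)) : Prop :=
  ∀ s t : P,
    (∀ m : P, IsLeastUpperBoundIn P {(s : G), (t : G)} m →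
      φ.alpha s 1 * φ.alpha t 1 = φ.alpha m 1) ∧
    ((¬ ∃ m : G, IsLeastUpperBoundIn P {(s : G), (t : G)} m) → φ.alpha s 1 * φ.alpha t 1 = 0)

/-! ### Twisted systems and crossed products -/

/-- The C*-subalgebra generated by a set `S` and the identity. -/
def generatedBy {B : Type*} [CStarAlgebra B] (S : Set B) : StarSubalgebra ℂ B :=
  (StarAlgebra.adjoin ℂ S).topologicalClosure

section crossed

variable {P : Type u} [Monoid P] {A : Type w} [CStarAlgebra A]

/-- A covariant representation `(π, φ)` of a twisted system `(A, P, β, E)`, where `β` is an action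
of `P` by (not necessarily unital) endomorphisms of the unital C*-algebra `A`:
`π (β_s a) = α^φ_s (π a)`. -/
def IsCovariantPair (β : P →* (A →⋆ₙₐ[ℂ] A)) (E : ProductSystem.{u, v} P)
    {H : Type*} [NormedAddCommGroup H] [InnerProductSpace ℂ H] [CompleteSpace H]
    (π : A →⋆ₐ[ℂ] (H →L[ℂ] H)) (φ : E.Rep (H →L[ℂ] H)) : Prop :=
  ∀ (s : P) (a : A), π (β s a) = φ.alpha s (π a)

/-- `(B, i_A, i_E)` is a crossed product for the twisted system `(A, P, β, E)`; Hilbert spaces range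
over the universe of `B`. -/
structure IsCrossedProduct (β : P →* (A →⋆ₙₐ[ℂ] A)) (E : ProductSystem.{u, v} P)
    {B : Type x} [CStarAlgebra B] (iA : A →⋆ₐ[ℂ] B) (iE : E.Rep B) : Prop where
  exists_faithful : ∃ (H : Type x) (_ : NormedAddCommGroup H) (_ : InnerProductSpace ℂ H)
    (_ : CompleteSpace H) (σ : B →⋆ₐ[ℂ] (H →L[ℂ] H)),
    Function.Injective σ ∧ IsCovariantPair β E (σ.comp iA) (iE.comp σ)
  exists_lift : ∀ (H : Type x) [NormedAddCommGroup H] [InnerProductSpace ℂ H] [CompleteSpace H]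
    (π : A →⋆ₐ[ℂ] (H →L[ℂ] H)) (φ : E.Rep (H →L[ℂ] H)), IsCovariantPair β E π φ →
    ∃ ρ : B →⋆ₐ[ℂ] (H →L[ℂ] H), (∀ a, ρ (iA a) = π a) ∧ ∀ z, ρ (iE z) = φ z
  generated : generatedBy (Set.range iA ∪ Set.range iE) = ⊤

end crossed

/-! ### The system `(B_P, P, τ, E)` -/

section translation

variable {G : Type u} [Group G] (P : Submonoid G)

/-- The C*-algebra `ℓ^∞(P)`. -/
abbrev LInfty : Type u := lp (fun _ : P => ℂ) ∞

open Classical in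
/-- The function `1_t` on `P`: `1_t(s) = 1` if `t ≤ s`, and `0` otherwise. -/
noncomputable def oneAbove (t : P) : LInfty P :=
  ⟨fun s => if PLe P (t : G) s then 1 else 0, memℓp_infty ⟨1, by
    rintro _ ⟨s, rfl⟩
    dsimp only
    split_ifs <;> simp⟩⟩

open Classical in
/-- Left translation by `s` of functions on `P`: `(τ_s f)(s r) = f(r)`, and `τ_s f` vanishes
off `sP`. -/
noncomputable def translateFun (s : P) (f : P → ℂ) (r : P) : ℂ :=
  if h : (s : G)⁻¹ * r ∈ P then f ⟨(s : G)⁻¹ * r, h⟩ else 0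

variable {P} in
theorem translateFun_of_mem (s : P) (f : P → ℂ) (r : P) (h : (s : G)⁻¹ * r ∈ P) :
    translateFun P s f r = f ⟨(s : G)⁻¹ * r, h⟩ := dif_pos h

variable {P} in
theorem translateFun_of_notMem (s : P) (f : P → ℂ) (r : P) (h : (s : G)⁻¹ * r ∉ P) :
    translateFun P s f r = 0 := dif_neg h

theorem translateFun_mul (s t : P) (f : P → ℂ) :
    translateFun P (s * t) f = translateFun P s (translateFun P t f) := by
  funext r
  have h0 : (↑(s * t) : G)⁻¹ * r = (t : G)⁻¹ * ((s : G)⁻¹ * r) := by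
    push_cast; group
  by_cases h : (s : G)⁻¹ * r ∈ P
  · rw [translateFun_of_mem s _ r h]
    by_cases h2 : (t : G)⁻¹ * ((s : G)⁻¹ * r) ∈ P
    · rw [translateFun_of_mem _ _ _ (h0 ▸ h2), translateFun_of_mem t _ ⟨_, h⟩ h2]
      simp only [h0]
    · rw [translateFun_of_notMem _ _ _ (h0 ▸ h2), translateFun_of_notMem t _ ⟨_, h⟩ h2]
  · rw [translateFun_of_notMem s _ r h, translateFun_of_notMem]
    intro h2
    apply h
    have := P.mul_mem t.2 h2
    rwa [h0, mul_inv_cancel_left] at this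

/-- Left translation by `s` as an endomorphism of `ℓ^∞(P)`. -/
noncomputable def leftTranslate (s : P) : LInfty P →⋆ₙₐ[ℂ] LInfty P where
  toFun f := ⟨translateFun P s f, memℓp_infty ⟨‖f‖, by
    rintro _ ⟨r, rfl⟩
    dsimp only
    by_cases h : (s : G)⁻¹ * r ∈ P
    · rw [translateFun_of_mem s _ r h]
      exact lp.norm_apply_le_norm (by simp) f _
    · simp [translateFun_of_notMem s _ r h]⟩⟩
  map_smul' c f := by
    ext r
    change translateFun P s (c • f : LInfty P) r = c • translateFun P s f r
    by_cases h : (s : G)⁻¹ * r ∈ P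
    · simp only [translateFun_of_mem s _ r h]; rfl
    · simp only [translateFun_of_notMem s _ r h, smul_zero]
  map_zero' := by
    ext r
    change translateFun P s (0 : LInfty P) r = 0
    by_cases h : (s : G)⁻¹ * r ∈ P
    · simp only [translateFun_of_mem s _ r h]; rfl
    · simp only [translateFun_of_notMem s _ r h]
  map_add' f g := by
    ext r
    change translateFun P s (f + g : LInfty P) r = translateFun P s f r + translateFun P s g r
    by_cases h : (s : G)⁻¹ * r ∈ P
    · simp only [translateFun_of_mem s _ r h]; rfl
    · simp only [translateFun_of_notMem s _ r h, add_zero]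
  map_mul' f g := by
    ext r
    change translateFun P s (f * g : LInfty P) r = translateFun P s f r * translateFun P s g r
    by_cases h : (s : G)⁻¹ * r ∈ P
    · simp only [translateFun_of_mem s _ r h]; rfl
    · simp only [translateFun_of_notMem s _ r h, mul_zero]
  map_star' f := by
    ext r
    change translateFun P s (star f : LInfty P) r = star (translateFun P s f r)
    by_cases h : (s : G)⁻¹ * r ∈ P
    · simp only [translateFun_of_mem s _ r h]; rfl
    · simp only [translateFun_of_notMem s _ r h, star_zero]

/-- `B_P`, the C*-subalgebra of `ℓ^∞(P)` generated by the projections `1_t`. -/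
noncomputable def BP : StarSubalgebra ℂ (LInfty P) := generatedBy (Set.range (oneAbove P))

variable {P} in
theorem oneAbove_of_le (t s : P) (h : PLe P (t : G) s) : oneAbove P t s = 1 := if_pos h

variable {P} in
theorem oneAbove_of_not_le (t s : P) (h : ¬ PLe P (t : G) s) : oneAbove P t s = 0 := if_neg h

theorem leftTranslate_oneAbove (s t : P) :
    leftTranslate P s (oneAbove P t) = oneAbove P (s * t) := by
  ext r
  change translateFun P s (oneAbove P t) r = _
  have h0 : (↑(s * t) : G)⁻¹ * r = (t : G)⁻¹ * ((s : G)⁻¹ * r) := by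
    push_cast; group
  by_cases h : (s : G)⁻¹ * r ∈ P
  · rw [translateFun_of_mem s _ r h]
    by_cases h2 : PLe P (t : G) ((s : G)⁻¹ * r)
    · rw [oneAbove_of_le t ⟨_, h⟩ h2, oneAbove_of_le]
      rwa [PLe, h0]
    · rw [oneAbove_of_not_le t ⟨_, h⟩ h2, oneAbove_of_not_le]
      rwa [PLe, h0]
  · rw [translateFun_of_notMem s _ r h, oneAbove_of_not_le]
    intro h2
    apply h
    have := P.mul_mem t.2 h2
    rwa [h0, mul_inv_cancel_left] at this

theorem oneAbove_one : oneAbove P 1 = 1 := by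
  ext r
  rw [oneAbove_of_le _ _ (by simp [PLe])]
  rfl

variable {P} in
theorem oneAbove_mul (s t m : P) (h : IsLeastUpperBoundIn P {(s : G), (t : G)} m) :
    oneAbove P s * oneAbove P t = oneAbove P m := by
  ext r
  rw [lp.infty_coeFn_mul, Pi.mul_apply]
  by_cases hr : PLe P (m : G) r
  · have key : ∀ y : G, PLe P y m → PLe P y r := fun y hy => by
      have := P.mul_mem hy hr
      rwa [mul_assoc, mul_inv_cancel_left] at this
    rw [oneAbove_of_le _ _ hr, oneAbove_of_le _ _ (key _ (h.1.2 _ (Or.inl rfl))),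
      oneAbove_of_le _ _ (key _ (h.1.2 _ (Or.inr rfl))), mul_one]
  · rw [oneAbove_of_not_le _ _ hr]
    by_cases h1 : PLe P (s : G) r
    · rw [oneAbove_of_not_le t, mul_zero]
      exact fun h2 => hr (h.2 r ⟨r.2, by rintro x (rfl | rfl); exacts [h1, h2]⟩)
    · rw [oneAbove_of_not_le _ _ h1, zero_mul]

variable {P} in
theorem oneAbove_mul_eq_zero (s t : P) (h : ¬ ∃ m, IsUpperBoundIn P {(s : G), (t : G)} m) :
    oneAbove P s * oneAbove P t = 0 := by
  ext r
  rw [lp.infty_coeFn_mul, Pi.mul_apply]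
  by_cases h1 : PLe P (s : G) r
  · rw [oneAbove_of_not_le t, mul_zero]
    · rfl
    · exact fun h2 => h ⟨r, r.2, by rintro x (rfl | rfl); exacts [h1, h2]⟩
  · rw [oneAbove_of_not_le _ _ h1, zero_mul]
    rfl

variable {P} in
/-- For a quasi-lattice ordered `P`, `B_P` is the closed linear span of the functions `1_t`. -/
theorem coe_BP (hP : IsQuasiLatticeOrdered P) :
    (BP P : Set (LInfty P)) = closure (Submodule.span ℂ (Set.range (oneAbove P)) : Set _) := by
  refine congrArg closure (Set.Subset.antisymm (fun f hf => ?_) ?_)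
  · induction hf using StarAlgebra.adjoin_induction with
    | mem x hx => exact Submodule.subset_span hx
    | algebraMap r =>
      rw [Algebra.algebraMap_eq_smul_one, ← oneAbove_one]
      exact Submodule.smul_mem _ r (Submodule.subset_span ⟨_, rfl⟩)
    | add x y _ _ hx hy => exact Submodule.add_mem _ hx hy
    | mul x y _ _ hx hy =>
      refine Submodule.span_induction₂ (p := fun x y _ _ =>
        x * y ∈ (Submodule.span ℂ (Set.range (oneAbove P)) : Set (LInfty P))) ?_ ?_ ?_ ?_ ?_ ?_ ?_
        hx hy
      · rintro _ _ ⟨s, rfl⟩ ⟨t, rfl⟩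
        by_cases h : ∃ m, IsUpperBoundIn P {(s : G), (t : G)} m
        · classical
          obtain ⟨m, hm⟩ := hP.exists_lub {(s : G), (t : G)} (by simpa using h)
          simp only [Finset.coe_insert, Finset.coe_singleton] at hm
          rw [oneAbove_mul s t ⟨m, hm.1.1⟩ hm]
          exact Submodule.subset_span ⟨_, rfl⟩
        · rw [oneAbove_mul_eq_zero s t h]
          exact Submodule.zero_mem _
      · intro y _; rw [zero_mul]; exact Submodule.zero_mem _
      · intro y _; rw [mul_zero]; exact Submodule.zero_mem _
      · intro x y z _ _ _ h1 h2; rw [add_mul]; exact Submodule.add_mem _ h1 h2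
      · intro x y z _ _ _ h1 h2; rw [mul_add]; exact Submodule.add_mem _ h1 h2
      · intro r x y _ _ h1; rw [smul_mul_assoc]; exact Submodule.smul_mem _ r h1
      · intro r x y _ _ h1; rw [mul_smul_comm]; exact Submodule.smul_mem _ r h1
    | star x _ hx =>
      refine Submodule.span_induction (p := fun x _ =>
        star x ∈ (Submodule.span ℂ (Set.range (oneAbove P)) : Set (LInfty P))) ?_ ?_ ?_ ?_ hx
      · rintro _ ⟨s, rfl⟩
        have : star (oneAbove P s) = oneAbove P s := by
          ext r
          rw [lp.star_apply]
          by_cases h : PLe P (s : G) r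
          · rw [oneAbove_of_le _ _ h, star_one]
          · rw [oneAbove_of_not_le _ _ h, star_zero]
        rw [this]
        exact Submodule.subset_span ⟨_, rfl⟩
      · rw [star_zero]; exact Submodule.zero_mem _
      · intro x y _ _ h1 h2; rw [star_add]; exact Submodule.add_mem _ h1 h2
      · intro r x _ h1; rw [star_smul]; exact Submodule.smul_mem _ _ h1
  · exact (Submodule.span_le (p := (StarAlgebra.adjoin ℂ
      (Set.range (oneAbove P))).toSubalgebra.toSubmodule)).2 (StarAlgebra.subset_adjoin ℂ _)

noncomputable instance : CStarAlgebra (BP P) :=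
  haveI : IsClosed ((BP P : StarSubalgebra ℂ (LInfty P)) : Set (LInfty P)) := isClosed_closure
  StarSubalgebra.cstarAlgebra (BP P)

open scoped CStarAlgebra in
theorem leftTranslate_mem (s : P) (f : LInfty P) (hf : f ∈ BP P) :
    leftTranslate P s f ∈ BP P := by
  have hc : Continuous (leftTranslate P s) := map_continuous (leftTranslate P s)
  refine map_mem_closure hc hf fun g hg => ?_
  induction hg using StarAlgebra.adjoin_induction with
  | mem x hx =>
    obtain ⟨t, rfl⟩ := hx
    rw [leftTranslate_oneAbove]
    exact StarAlgebra.subset_adjoin ℂ _ ⟨_, rfl⟩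
  | algebraMap r =>
    rw [Algebra.algebraMap_eq_smul_one, map_smul, ← oneAbove_one, leftTranslate_oneAbove]
    exact SMulMemClass.smul_mem r (StarAlgebra.subset_adjoin ℂ _ ⟨_, rfl⟩)
  | add x y _ _ hx hy => rw [map_add]; exact add_mem hx hy
  | mul x y _ _ hx hy => rw [map_mul]; exact mul_mem hx hy
  | star x _ hx => rw [map_star]; exact star_mem hx

/-- The action `τ` of `P` on `B_P` by left translation; it satisfies `τ_s(1_t) = 1_{st}`. -/
noncomputable def translationAction : P →* (BP P →⋆ₙₐ[ℂ] BP P) where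
  toFun s :=
    { toFun := fun f => ⟨leftTranslate P s f, leftTranslate_mem P s f f.2⟩
      map_smul' := fun c f => Subtype.ext (map_smul (leftTranslate P s) c (f : LInfty P))
      map_zero' := Subtype.ext (map_zero (leftTranslate P s))
      map_add' := fun f g => Subtype.ext (map_add (leftTranslate P s) (f : LInfty P) g)
      map_mul' := fun f g => Subtype.ext (map_mul (leftTranslate P s) (f : LInfty P) g)
      map_star' := fun f => Subtype.ext (map_star (leftTranslate P s) (f : LInfty P)) }
  map_one' := by
    ext f r
    change translateFun P 1 (f : LInfty P) r = (f : LInfty P) r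
    rw [translateFun_of_mem _ _ _ (by simp)]
    simp
  map_mul' s t := by
    ext f r
    exact congrFun (translateFun_mul P s t (f : LInfty P)) r

end translation

/-- The C*-subalgebra generated by the range of `i_E`; its identity is the value of `i_E` at the
identity of `E`. -/
def ProductSystem.Rep.generatedAlgebra {P : Type u} [Monoid P] {E : ProductSystem.{u, v} P}
    {B : Type w} [CStarAlgebra B] (iE : E.Rep B) : StarSubalgebra ℂ B :=
  generatedBy (Set.range iE)

/-- `i_E`, viewed as a map into the C*-algebra generated by its range. -/
def ProductSystem.Rep.toGenerated {P : Type u} [Monoid P] {E : ProductSystem.{u, v} P}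
    {B : Type w} [CStarAlgebra B] (iE : E.Rep B) : E.Rep iE.generatedAlgebra :=
  iE.codRestrict iE.generatedAlgebra fun z =>
    StarSubalgebra.le_topologicalClosure _ (StarAlgebra.subset_adjoin ℂ _ ⟨z, rfl⟩)

/-! ### C*-algebras given by generators -/

section generators

/-! A covariant representation of `E` is the same thing as a covariant representation of the system,
and this is what makes `A` universal. In one direction, evaluating `π ∘ τ_t = α_t ∘ π` at 1 gives
`α_t(1) = π(1_t)`, and the functions `1_t` multiply by the lattice rule
(`IsCovariantPair.isCovariant`). In the other, covariance of `φ` says that the projections `α_t(1)`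
multiply like the `1_t`. The algebra `B_P` is universal for such families
(`IsLatticeFamily.exists_starAlgHom`), so some `π` has `π(1_t) = α_t(1)`. Covariance of the pair
then follows from `α_s ∘ α_t = α_{st}` and density. Statements (a) and (b) are the two properties of
the crossed product, restricted to `A`.

Universality of `B_P` is a norm estimate. A character of the commutative algebra generated by the
projections takes the values 0 and 1 on them. On finitely many indices it is evaluation at a point
of `P`, namely an upper bound of the indices with value 1, so a linear combination of the
projections is no larger in norm than the same combination of the `1_t`.

A crossed product exists because the seminorms which covariant pairs induce on `*`-polynomials form
a set. One pair for each seminorm is chosen, and their direct sum dominates every pair; the crossed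
product is the C*-algebra which it generates.

If the fibres are finite-dimensional, `i_B(1_t)` is the finite sum of the `i_E(u) i_E(u)^*`, hence
lies in `A`, so `A` is everything. For `z` over `s` and `y` over `t`, inserting `1_s 1_t = 1_{s ∨
t}` in `i_E(z)^* i_E(y)` rewrites it as a sum of words `i_E(f) i_E(g)^*`, or as 0. The span of these
words is therefore already a `*`-algebra (`adjoin_le_wordSpan`). -/

theorem subset_generatedBy {B : Type*} [CStarAlgebra B] (S : Set B) : S ⊆ generatedBy S :=
  (StarAlgebra.subset_adjoin ℂ S).trans (StarSubalgebra.le_topologicalClosure _)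

instance isClosed_generatedBy {B : Type*} [CStarAlgebra B] (S : Set B) :
    IsClosed (generatedBy S : Set B) :=
  StarSubalgebra.isClosed_topologicalClosure _

theorem generatedBy_le {B : Type*} [CStarAlgebra B] {S : Set B} {A : StarSubalgebra ℂ B}
    (hA : IsClosed (A : Set B)) (h : S ⊆ A) : generatedBy S ≤ A :=
  StarSubalgebra.topologicalClosure_minimal (StarAlgebra.adjoin_le h) hA

noncomputable instance {B : Type*} [CStarAlgebra B] (S : Set B) : CStarAlgebra (generatedBy S) :=
  StarSubalgebra.cstarAlgebra (generatedBy S)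

/-- The `*`-algebra generated by a self-adjoint set which contains the identity and is closed under
multiplication, all up to linear combinations, is the span of that set. -/
theorem adjoin_le_span {B : Type*} [CStarAlgebra B] {S : Set B}
    (h1 : (1 : B) ∈ Submodule.span ℂ S) (hs : ∀ x ∈ S, star x ∈ Submodule.span ℂ S)
    (hm : ∀ x ∈ S, ∀ y ∈ S, x * y ∈ Submodule.span ℂ S) :
    (StarAlgebra.adjoin ℂ S : Set B) ⊆ Submodule.span ℂ S := by
  intro f hf
  induction hf using StarAlgebra.adjoin_induction with
  | mem x hx => exact Submodule.subset_span hx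
  | algebraMap r =>
    rw [Algebra.algebraMap_eq_smul_one]
    exact Submodule.smul_mem _ r h1
  | add x y _ _ hx hy => exact Submodule.add_mem _ hx hy
  | mul x y _ _ hx hy =>
    refine Submodule.span_induction₂ (p := fun x y _ _ => x * y ∈ Submodule.span ℂ S)
      (fun x y hx hy => hm x hx y hy) ?_ ?_ ?_ ?_ ?_ ?_ hx hy
    · intro y _; rw [zero_mul]; exact Submodule.zero_mem _
    · intro y _; rw [mul_zero]; exact Submodule.zero_mem _
    · intro x y z _ _ _ h1 h2; rw [add_mul]; exact Submodule.add_mem _ h1 h2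
    · intro x y z _ _ _ h1 h2; rw [mul_add]; exact Submodule.add_mem _ h1 h2
    · intro r x y _ _ h1; rw [smul_mul_assoc]; exact Submodule.smul_mem _ r h1
    · intro r x y _ _ h1; rw [mul_smul_comm]; exact Submodule.smul_mem _ r h1
  | star x _ hx =>
    refine Submodule.span_induction (p := fun x _ => star x ∈ Submodule.span ℂ S)
      (fun x hx => hs x hx) ?_ ?_ ?_ hx
    · rw [star_zero]; exact Submodule.zero_mem _
    · intro x y _ _ h1 h2; rw [star_add]; exact Submodule.add_mem _ h1 h2
    · intro r x _ h1; rw [star_smul]; exact Submodule.smul_mem _ _ h1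

/-- A C*-algebra generated by `S` is generated by `S` inside itself. -/
theorem generatedBy_preimage_eq_top {B : Type*} [CStarAlgebra B] (S : Set B) :
    generatedBy ((↑) ⁻¹' S : Set (generatedBy S)) = ⊤ := by
  have h2 : ((generatedBy S).subtype '' ((↑) ⁻¹' S : Set (generatedBy S))) = S :=
    (Subtype.image_preimage_coe _ _).trans (Set.inter_eq_right.2 (subset_generatedBy S))
  set T := StarAlgebra.adjoin ℂ ((↑) ⁻¹' S : Set (generatedBy S)) with hT
  have h : (StarAlgebra.adjoin ℂ S : Set B) ⊆ (↑) '' (T : Set (generatedBy S)) := by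
    have h3 := StarAlgHom.map_adjoin (generatedBy S).subtype ((↑) ⁻¹' S : Set (generatedBy S))
    rw [h2] at h3
    rw [← h3, StarSubalgebra.coe_map]
    rfl
  have hb : ∀ b : generatedBy S, b ∈ closure (T : Set (generatedBy S)) := by
    intro b
    rw [closure_subtype]
    have hb : (b : B) ∈ closure (StarAlgebra.adjoin ℂ S : Set B) := b.2
    exact closure_mono h hb
  exact StarSubalgebra.eq_top_iff.2 hb

/-- An assignment `x i ↦ y i` of generators extends to a `*`-homomorphism as soon as it does not
increase the norm of `*`-polynomials. -/
theorem exists_starAlgHom_of_norm_le {A C ι : Type*} [CStarAlgebra A] [CStarAlgebra C]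
    (x : ι → A) (y : ι → C)
    (h : ∀ d ∈ StarAlgebra.adjoin ℂ (Set.range fun i => (x i, y i)), ‖d.2‖ ≤ ‖d.1‖) :
    ∃ ρ : generatedBy (Set.range x) →⋆ₐ[ℂ] C,
      ∀ i, ρ ⟨x i, subset_generatedBy _ ⟨i, rfl⟩⟩ = y i := by
  set D := generatedBy (Set.range fun i => (x i, y i)) with hD
  have hnorm : ∀ d ∈ D, ‖d.2‖ ≤ ‖d.1‖ := fun d hd =>
    closure_minimal (t := {d : A × C | ‖d.2‖ ≤ ‖d.1‖}) h
      (isClosed_le (by fun_prop) (by fun_prop)) hd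
  -- `D` is the graph of the wanted homomorphism. The norm of a pair is the maximum of the two
  -- norms, so the hypothesis makes the first projection isometric on `D`. Its range is then closed
  -- and contains all the `x i`; inverting it and projecting to `C` gives `ρ`.
  let f : D →⋆ₐ[ℂ] A := (StarAlgHom.fst ℂ A C).comp D.subtype
  have hf : Isometry f := AddMonoidHomClass.isometry_of_norm f fun d =>
    (max_eq_left (hnorm d d.2)).symm
  have hclosed : IsClosed (f.range : Set A) := by
    have := hf.isClosedEmbedding.isClosed_range
    have h2 : (f.range : Set A) = Set.range f := by ext; rfl
    rwa [h2]
  have hgen : ∀ i, (x i, y i) ∈ D := fun i => subset_generatedBy _ ⟨i, rfl⟩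
  have hle : generatedBy (Set.range x) ≤ f.range := by
    refine generatedBy_le hclosed ?_
    rintro _ ⟨i, rfl⟩
    exact ⟨⟨_, hgen i⟩, rfl⟩
  let e := StarAlgEquiv.ofInjective f hf.injective
  refine ⟨((StarAlgHom.snd ℂ A C).comp D.subtype).comp
    ((e.symm : f.range →⋆ₐ[ℂ] D).comp (StarSubalgebra.inclusion hle)), fun i => ?_⟩
  have h1 : e ⟨(x i, y i), hgen i⟩ = StarSubalgebra.inclusion hle
      ⟨x i, subset_generatedBy _ ⟨i, rfl⟩⟩ := rfl
  change (e.symm (StarSubalgebra.inclusion hle ⟨x i, subset_generatedBy _ ⟨i, rfl⟩⟩) : A × C).2 = _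
  rw [← h1, e.symm_apply_apply]

end generators

/-! ### Product systems -/

namespace ProductSystem

variable {P : Type u} [Monoid P]

/-- The unitary carries the algebraic tensor product, dense in its completion, into the span of the
products. -/
theorem dense_span_mul (E : ProductSystem.{u, v} P) (s t : P) :
    Dense (Submodule.span ℂ {w : E.fibre (s * t) | ∃ (x : E.fibre s) (y : E.fibre t),
      w = E.mul x y} : Set (E.fibre (s * t))) := by
  obtain ⟨U, hU⟩ := E.exists_unitary s t
  have h1 : Dense (U '' Set.range ((↑) : E.fibre s ⊗[ℂ] E.fibre t →
      UniformSpace.Completion (E.fibre s ⊗[ℂ] E.fibre t))) :=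
    U.surjective.denseRange.dense_image U.continuous UniformSpace.Completion.denseRange_coe
  refine h1.mono ?_
  rintro _ ⟨_, ⟨z, rfl⟩, rfl⟩
  induction z using TensorProduct.induction_on with
  | zero =>
    rw [UniformSpace.Completion.coe_zero, map_zero]
    exact Submodule.zero_mem _
  | tmul x y => exact Submodule.subset_span ⟨x, y, hU x y⟩
  | add x y hx hy =>
    rw [UniformSpace.Completion.coe_add, map_add]
    exact Submodule.add_mem _ hx hy

namespace Rep

variable {E : ProductSystem.{u, v} P}

theorem map_incl_mul {B : Type w} [Ring B] [StarRing B] [Algebra ℂ B] (φ : E.Rep B) {s t : P}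
    (x : E.fibre s) (y : E.fibre t) :
    φ (E.incl (E.mul x y)) = φ (E.incl x) * φ (E.incl y) :=
  φ.map_mul' (E.incl x) (E.incl y)

variable {H : Type w} [NormedAddCommGroup H] [InnerProductSpace ℂ H] [CompleteSpace H]

theorem alpha_apply_map (φ : E.Rep (H →L[ℂ] H)) {t : P} (A : H →L[ℂ] H) (u : E.fibre t) (h : H) :
    φ.alpha t A (φ (E.incl u) h) = φ (E.incl u) (A h) :=
  φ.basisSum_mul _ A u h

theorem alpha_eq_zero (φ : E.Rep (H →L[ℂ] H)) {t : P} (A : H →L[ℂ] H) (x : H)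
    (hx : ∀ u : E.fibre t, star (φ (E.incl u)) x = 0) : φ.alpha t A x = 0 :=
  φ.basisSum_eq_zero _ A x hx

/-- `α_t(A)` is determined by its intertwining property and its vanishing on the orthogonal
complement of `φ(E_t) H`. -/
theorem eq_alpha (φ : E.Rep (H →L[ℂ] H)) {t : P} (A T : H →L[ℂ] H)
    (h1 : ∀ (u : E.fibre t) (h : H), T (φ (E.incl u) h) = φ (E.incl u) (A h))
    (h2 : ∀ x : H, (∀ u : E.fibre t, star (φ (E.incl u)) x = 0) → T x = 0) :
    T = φ.alpha t A := by
  ext x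
  let b := (exists_hilbertBasis ℂ (E.fibre t)).choose_spec.choose
  -- The vector `φ.basisSum b 1 x` is the projection of `x` to the closed span of `φ(E_t) H`. The
  -- two operators agree there by intertwining, and both kill the remainder of `x`.
  have h3 : T (φ.basisSum b 1 x) = φ.alpha t A (φ.basisSum b 1 x) := by
    refine ((φ.hasSum_basisSum b 1 x).mapL T).unique ?_
    convert (φ.hasSum_basisSum b 1 x).mapL (φ.alpha t A) using 2 with i
    rw [mul_apply_eq_comp, mul_apply_eq_comp, h1, alpha_apply_map]
  have h4 := h2 _ (φ.star_basisSum_one b x)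
  have h5 := φ.alpha_eq_zero A _ (φ.star_basisSum_one b x)
  rw [map_sub, sub_eq_zero] at h4 h5
  rw [h4, h5, h3]

theorem alpha_add (φ : E.Rep (H →L[ℂ] H)) (t : P) (A B : H →L[ℂ] H) :
    φ.alpha t (A + B) = φ.alpha t A + φ.alpha t B := by
  refine (φ.eq_alpha _ _ (fun u h => ?_) fun x hx => ?_).symm
  · simp [alpha_apply_map]
  · simp [φ.alpha_eq_zero _ x hx]

theorem alpha_smul (φ : E.Rep (H →L[ℂ] H)) (t : P) (c : ℂ) (A : H →L[ℂ] H) :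
    φ.alpha t (c • A) = c • φ.alpha t A := by
  refine (φ.eq_alpha _ _ (fun u h => ?_) fun x hx => ?_).symm
  · simp [alpha_apply_map]
  · simp [φ.alpha_eq_zero _ x hx]

theorem norm_alpha_le (φ : E.Rep (H →L[ℂ] H)) (t : P) (A : H →L[ℂ] H) : ‖φ.alpha t A‖ ≤ ‖A‖ := by
  let b := (exists_hilbertBasis ℂ (E.fibre t)).choose_spec.choose
  exact ContinuousLinearMap.opNorm_le_bound _ (norm_nonneg _) fun x =>
    le_of_tendsto (φ.hasSum_alpha b A x).norm (Filter.Eventually.of_forall (φ.sum_norm_le b A x))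

/-- `α_t` as a bounded operator on `B(H)`. -/
noncomputable def alphaCLM (φ : E.Rep (H →L[ℂ] H)) (t : P) : (H →L[ℂ] H) →L[ℂ] (H →L[ℂ] H) :=
  LinearMap.mkContinuous
    { toFun := φ.alpha t
      map_add' := φ.alpha_add t
      map_smul' := φ.alpha_smul t } 1
    fun A => by simpa using φ.norm_alpha_le t A

/-- Both conditions of `eq_alpha` are checked. The intertwining need only hold on products `xy`,
whose span is dense in the fibre over `s * t`. If `x` is killed by all `φ(w)^*` with `w` over `s *
t`, then each `φ(b_i)^* x` is killed by all `φ(u)^*` with `u` over `t`. -/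
theorem alpha_mul (φ : E.Rep (H →L[ℂ] H)) (s t : P) (A : H →L[ℂ] H) :
    φ.alpha s (φ.alpha t A) = φ.alpha (s * t) A := by
  refine φ.eq_alpha _ _ (fun w h => ?_) fun x hx => ?_
  · have hc : φ.alpha s (φ.alpha t A) ∘L φ.applyCLM (s * t) h = φ.applyCLM (s * t) (A h) := by
      refine ContinuousLinearMap.ext_on (E.dense_span_mul s t) ?_
      rintro _ ⟨x, y, rfl⟩
      simp [applyCLM_apply, map_incl_mul, alpha_apply_map]
    exact congrArg (fun T => T w) hc
  · refine HasSum.unique (φ.hasSum_alpha (exists_hilbertBasis ℂ (E.fibre s)).choose_spec.choose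
      (φ.alpha t A) x) ?_
    convert hasSum_zero with i
    rw [mul_apply_eq_comp, mul_apply_eq_comp, φ.alpha_eq_zero, map_zero]
    intro u
    rw [← mul_apply_eq_comp, ← star_mul, ← map_incl_mul]
    exact hx _

theorem star_map_alpha_one (φ : E.Rep (H →L[ℂ] H)) {t : P} (u : E.fibre t) :
    star (φ (E.incl u)) * φ.alpha t 1 = star (φ (E.incl u)) := by
  ext x
  have := φ.star_basisSum_one (exists_hilbertBasis ℂ (E.fibre t)).choose_spec.choose x u
  rw [map_sub, sub_eq_zero] at this
  exact this.symm

/-- By `eq_alpha`, `α_t(1)^* α_t(1) = α_t(1)`, and the left side is self-adjoint. -/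
theorem star_alpha_one (φ : E.Rep (H →L[ℂ] H)) (t : P) : star (φ.alpha t 1) = φ.alpha t 1 := by
  have h : star (φ.alpha t 1) * φ.alpha t 1 = φ.alpha t 1 := by
    refine φ.eq_alpha _ _ (fun u h => ?_) fun x hx => ?_
    · have h1 := congrArg star (φ.star_map_alpha_one u)
      rw [star_mul, star_star] at h1
      rw [mul_apply_eq_comp, alpha_apply_map, ← mul_apply_eq_comp, h1]
    · rw [mul_apply_eq_comp, φ.alpha_eq_zero _ x hx, map_zero]
  rw [← h, star_mul, star_star]

/-- A unit vector `u` of the one-dimensional fibre over 1 has `u u = c u`. Cancelling the isometry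
`φ(u)` gives `φ(u) = c 1`, so only 0 is killed by `φ(u)^*`. -/
theorem alpha_one_one (φ : E.Rep (H →L[ℂ] H)) : φ.alpha 1 1 = 1 := by
  refine (φ.eq_alpha 1 1 (fun _ _ => rfl) fun x hx => ?_).symm
  obtain ⟨u, hu⟩ := exists_norm_eq (E.fibre 1) zero_le_one
  have hu0 : u ≠ 0 := by rintro rfl; simp at hu
  have hiso : star (φ (E.incl u)) * φ (E.incl u) = 1 := by
    rw [φ.star_mul', inner_self_eq_norm_sq_to_K, hu]; simp
  -- The product lives in the fibre over `1 * 1`; the total space lets it be read in the fibre over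
  -- 1.
  obtain ⟨v, hv⟩ : ∃ v : E.fibre 1, E.incl u * E.incl u = E.incl v := by
    have key : ∀ z : E.Total, z.1 = 1 → ∃ v : E.fibre 1, z = E.incl v := by
      rintro ⟨t, z⟩ (rfl : t = 1)
      exact ⟨z, rfl⟩
    exact key _ (mul_one (1 : P))
  obtain ⟨c, rfl⟩ := (finrank_eq_one_iff_of_nonzero' u hu0).1 E.finrank_fibre_one v
  have h0 : φ (E.incl (0 : E.fibre 1)) = 0 := by
    ext h
    rw [zero_apply, ← norm_eq_zero, norm_apply]
    simp
  have hc : φ (E.incl u) = c • 1 := by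
    have h1 := φ.map_mul' (E.incl u) (E.incl u)
    rw [hv] at h1
    have h2 := φ.map_linear c u 0
    rw [add_zero, h0, add_zero] at h2
    rw [h2] at h1
    have h3 := congrArg (fun T => star (φ (E.incl u)) * T) h1
    simpa [← mul_assoc, hiso] using h3.symm
  have h4 := hx u
  have h5 : (star (φ (E.incl u)) * φ (E.incl u)) x = 0 := by
    rw [hc] at h4 ⊢
    rw [mul_smul_comm, mul_one, smul_apply, h4, smul_zero]
  rw [hiso] at h5
  exact h5

end Rep

end ProductSystem

/-! ### Representations of `B_P` -/

section projections

/-- The generated algebra lies in the double centralizer of `S`, which is commutative because `S` is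
commutative and self-adjoint. -/
theorem generatedBy_mul_comm {B : Type*} [CStarAlgebra B] {S : Set B}
    (hstar : ∀ x ∈ S, star x = x) (hcomm : ∀ x ∈ S, ∀ y ∈ S, x * y = y * x) {a b : B}
    (ha : a ∈ generatedBy S) (hb : b ∈ generatedBy S) : a * b = b * a := by
  have hS : star S = S := by
    ext x
    rw [Set.mem_star]
    refine ⟨fun h => ?_, fun h => by rwa [hstar x h]⟩
    have h2 := hstar _ h
    rw [star_star] at h2
    rwa [← h2] at h
  have := StarSubalgebra.topologicalClosure_adjoin_le_centralizer_centralizer ℂ S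
  have ha := this ha
  have hb := this hb
  rw [← SetLike.mem_coe, StarSubalgebra.coe_centralizer_centralizer, hS, Set.union_self] at ha hb
  exact Set.centralizer_centralizer_comm_of_comm hcomm _ ha _ hb

variable {G : Type u} [Group G] {P : Submonoid G}

/-- A family of projections indexed by `P`, multiplying like the functions `1_t`. -/
structure IsLatticeFamily {C : Type*} [CStarAlgebra C] (Q : P → C) : Prop where
  map_one : Q 1 = 1
  star_eq : ∀ t, star (Q t) = Q t
  mul_eq : ∀ s t m : P, IsLeastUpperBoundIn P {(s : G), (t : G)} m → Q s * Q t = Q m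
  mul_eq_zero : ∀ s t : P, (¬ ∃ m : G, IsLeastUpperBoundIn P {(s : G), (t : G)} m) →
    Q s * Q t = 0

theorem PLe.refl (s : G) : PLe P s s := by simp [PLe]

theorem PLe.trans {r s t : G} (h1 : PLe P r s) (h2 : PLe P s t) : PLe P r t := by
  have := P.mul_mem h1 h2
  rwa [mul_assoc, mul_inv_cancel_left] at this

theorem isLeastUpperBoundIn_of_le {s t : P} (h : PLe P (s : G) t) :
    IsLeastUpperBoundIn P {(s : G), (t : G)} t :=
  ⟨⟨t.2, by rintro x (rfl | rfl); exacts [h, PLe.refl _]⟩, fun _ hm => hm.2 _ (Or.inr rfl)⟩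

namespace IsLatticeFamily

variable {C : Type*} [CStarAlgebra C] {Q : P → C}

theorem mul_self (hQ : IsLatticeFamily Q) (t : P) : Q t * Q t = Q t :=
  hQ.mul_eq t t t (isLeastUpperBoundIn_of_le (PLe.refl _))

theorem mul_of_le (hQ : IsLatticeFamily Q) {s t : P} (h : PLe P (s : G) t) : Q s * Q t = Q t :=
  hQ.mul_eq s t t (isLeastUpperBoundIn_of_le h)

theorem mul_comm (hQ : IsLatticeFamily Q) (s t : P) : Q s * Q t = Q t * Q s := by
  by_cases h : ∃ m : G, IsLeastUpperBoundIn P {(s : G), (t : G)} m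
  · obtain ⟨m, hm⟩ := h
    rw [hQ.mul_eq s t ⟨m, hm.1.1⟩ hm, hQ.mul_eq t s ⟨m, hm.1.1⟩ (by rwa [Set.pair_comm])]
  · rw [hQ.mul_eq_zero s t h, hQ.mul_eq_zero t s (by rwa [Set.pair_comm])]

/-- A character of the projections agrees, on a finite set, with the evaluation at a point. -/
theorem exists_eval (hQ : IsLatticeFamily Q) {R : Type*} [Ring R] [IsDomain R] (χ : P → R)
    (h1 : χ 1 = 1) (hmul : ∀ s t m, Q s * Q t = Q m → χ s * χ t = χ m)
    (hzero : ∀ s t, Q s * Q t = 0 → χ s * χ t = 0) (F : Finset P) :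
    ∃ m : P, ∀ t ∈ F, (PLe P (t : G) m → χ t = 1) ∧ (¬ PLe P (t : G) m → χ t = 0) := by
  classical
  -- To adjoin `s` to a set with upper bound `m`, note that `χ s * χ m = 1` is not 0. Hence `s ∨ m`
  -- exists by `hzero`, and `χ` is 1 there by `hmul`.
  have key : ∀ A : Finset P, (∀ t ∈ A, χ t = 1) → ∃ m : P, χ m = 1 ∧ ∀ t ∈ A, PLe P (t : G) m := by
    intro A
    induction A using Finset.induction_on with
    | empty => exact fun _ => ⟨1, h1, by simp⟩
    | insert s A _ ih =>
      intro hA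
      obtain ⟨m, hm, hle⟩ := ih fun t ht => hA t (Finset.mem_insert_of_mem ht)
      have hs := hA s (Finset.mem_insert_self _ _)
      by_cases h : ∃ n : G, IsLeastUpperBoundIn P {(s : G), (m : G)} n
      · obtain ⟨n, hn⟩ := h
        refine ⟨⟨n, hn.1.1⟩, ?_, fun t ht => ?_⟩
        · rw [← hmul s m _ (hQ.mul_eq s m ⟨n, hn.1.1⟩ hn), hs, hm, one_mul]
        · rcases Finset.mem_insert.1 ht with rfl | ht
          · exact hn.1.2 _ (Or.inl rfl)
          · exact (hle t ht).trans (hn.1.2 _ (Or.inr rfl))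
      · have := hzero s m (hQ.mul_eq_zero s m h)
        rw [hs, hm, one_mul] at this
        exact absurd this one_ne_zero
  -- The point is an upper bound of the indices in `F` where `χ` is 1. Below it `χ t = χ t * χ m = χ
  -- m = 1`; an index of `F` not below it has value 0, the only other idempotent of a domain.
  obtain ⟨m, hm, hle⟩ := key (F.filter fun t => χ t = 1) fun t ht => (Finset.mem_filter.1 ht).2
  refine ⟨m, fun t ht => ⟨fun h => ?_, fun h => ?_⟩⟩
  · have := hmul t m m (hQ.mul_of_le h)
    rwa [hm, mul_one] at this
  · have h2 := hmul t t t (hQ.mul_self t)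
    by_contra h0
    exact h (hle t (Finset.mem_filter.2 ⟨ht, mul_left_cancel₀ h0 (by rw [h2, mul_one])⟩))

/-- The Gelfand transform computes the left side as a supremum over characters. On the support of
`l` each character is evaluation at some `m`, so its value on the sum is a value of the function on
the right. -/
theorem norm_sum_le (hQ : IsLatticeFamily Q) (l : P →₀ ℂ) :
    ‖l.sum fun t c => c • Q t‖ ≤ ‖l.sum fun t c => c • oneAbove P t‖ := by
  let _ : CommCStarAlgebra (generatedBy (Set.range Q)) :=
    { (inferInstance : CStarAlgebra (generatedBy (Set.range Q))) with
      mul_comm := fun a b => Subtype.ext (generatedBy_mul_comm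
        (by rintro _ ⟨t, rfl⟩; exact hQ.star_eq t)
        (by rintro _ ⟨s, rfl⟩ _ ⟨t, rfl⟩; exact hQ.mul_comm s t) a.2 b.2) }
  let q : P → generatedBy (Set.range Q) := fun t => ⟨Q t, subset_generatedBy _ ⟨t, rfl⟩⟩
  have hq : ((l.sum fun t c => c • q t : generatedBy (Set.range Q)) : C)
      = l.sum fun t c => c • Q t := by
    simp only [Finsupp.sum]
    exact map_sum (generatedBy (Set.range Q)).subtype _ _
  have hn : ‖WeakDual.gelfandTransform ℂ _ (l.sum fun t c => c • q t)‖ = ‖l.sum fun t c => c • Q t‖ := by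
    rw [← hq]
    exact (gelfandTransform_isometry _).norm_map_of_map_zero (map_zero _) _
  rw [← hn]
  refine (ContinuousMap.norm_le _ (norm_nonneg _)).2 fun χ => ?_
  obtain ⟨m, hm⟩ := hQ.exists_eval (fun t => χ (q t))
    (by
      have : q 1 = 1 := Subtype.ext hQ.map_one
      exact (congrArg χ this).trans (_root_.map_one χ))
    (fun s t m h => by
      have : q s * q t = q m := Subtype.ext h
      simp only [← map_mul, this])
    (fun s t h => by
      have : q s * q t = 0 := Subtype.ext h
      simp only [← map_mul, this, map_zero]) l.support
  have heval : WeakDual.gelfandTransform ℂ _ (l.sum fun t c => c • q t) χ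
      = (l.sum fun t c => c • oneAbove P t) m := by
    rw [WeakDual.gelfandTransform_apply_apply, Finsupp.sum, Finsupp.sum, lp.coeFn_sum,
      Finset.sum_apply, map_sum]
    refine Finset.sum_congr rfl fun t ht => ?_
    rw [map_smul, lp.coeFn_smul, Pi.smul_apply]
    congr 1
    by_cases h : PLe P (t : G) m
    · rw [oneAbove_of_le _ _ h]; exact (hm t ht).1 h
    · rw [oneAbove_of_not_le _ _ h]; exact (hm t ht).2 h
  rw [heval]
  exact lp.norm_apply_le_norm (by simp) _ m

end IsLatticeFamily

theorem oneAbove_mem_BP (t : P) : oneAbove P t ∈ BP P := subset_generatedBy _ ⟨t, rfl⟩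

theorem star_oneAbove (t : P) : star (oneAbove P t) = oneAbove P t := by
  ext r
  rw [lp.star_apply]
  by_cases h : PLe P (t : G) r
  · rw [oneAbove_of_le _ _ h, star_one]
  · rw [oneAbove_of_not_le _ _ h, star_zero]

theorem IsQuasiLatticeOrdered.exists_lub_pair (hP : IsQuasiLatticeOrdered P) {s t : G}
    (h : ∃ m, IsUpperBoundIn P {s, t} m) : ∃ m, IsLeastUpperBoundIn P {s, t} m := by
  classical
  simpa using hP.exists_lub {s, t} (by simpa using h)

/-- The quasi-lattice order enters in the last field: where there is no least upper bound there is
no upper bound at all, so the two supports are disjoint. -/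
theorem isLatticeFamily_oneAbove (hP : IsQuasiLatticeOrdered P) :
    IsLatticeFamily (oneAbove P) where
  map_one := oneAbove_one P
  star_eq := star_oneAbove
  mul_eq := oneAbove_mul
  mul_eq_zero s t h := oneAbove_mul_eq_zero s t fun h2 => h (hP.exists_lub_pair h2)

namespace IsLatticeFamily

variable {C : Type*} [CStarAlgebra C] {Q : P → C}

theorem prodMk {D : Type*} [CStarAlgebra D] {R : P → D} (hR : IsLatticeFamily R)
    (hQ : IsLatticeFamily Q) : IsLatticeFamily fun t => (R t, Q t) where
  map_one := Prod.ext hR.map_one hQ.map_one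
  star_eq t := Prod.ext (hR.star_eq t) (hQ.star_eq t)
  mul_eq s t m h := Prod.ext (hR.mul_eq s t m h) (hQ.mul_eq s t m h)
  mul_eq_zero s t h := Prod.ext (hR.mul_eq_zero s t h) (hQ.mul_eq_zero s t h)

theorem adjoin_le_span (hQ : IsLatticeFamily Q) :
    (StarAlgebra.adjoin ℂ (Set.range Q) : Set C) ⊆ Submodule.span ℂ (Set.range Q) := by
  refine _root_.adjoin_le_span (Submodule.subset_span ⟨1, hQ.map_one⟩) ?_ ?_
  · rintro _ ⟨t, rfl⟩
    rw [hQ.star_eq]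
    exact Submodule.subset_span ⟨t, rfl⟩
  · rintro _ ⟨s, rfl⟩ _ ⟨t, rfl⟩
    by_cases h : ∃ m : G, IsLeastUpperBoundIn P {(s : G), (t : G)} m
    · obtain ⟨m, hm⟩ := h
      rw [hQ.mul_eq s t ⟨m, hm.1.1⟩ hm]
      exact Submodule.subset_span ⟨_, rfl⟩
    · rw [hQ.mul_eq_zero s t h]
      exact Submodule.zero_mem _

/-- `B_P` is universal for families of projections multiplying like the functions `1_t`. -/
theorem exists_starAlgHom (hP : IsQuasiLatticeOrdered P) (hQ : IsLatticeFamily Q) :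
    ∃ π : BP P →⋆ₐ[ℂ] C, ∀ t, π ⟨oneAbove P t, oneAbove_mem_BP t⟩ = Q t := by
  refine exists_starAlgHom_of_norm_le (oneAbove P) Q fun d hd => ?_
  -- Spanning in the product algebra gives both coordinates of `d` the same coefficients `l`.
  have h1 := ((isLatticeFamily_oneAbove hP).prodMk hQ).adjoin_le_span hd
  obtain ⟨l, rfl⟩ := Finsupp.mem_span_range_iff_exists_finsupp.1 h1
  have h2 : (l.sum fun t c => c • (oneAbove P t, Q t)).1 = l.sum fun t c => c • oneAbove P t := by
    rw [Finsupp.sum, Finsupp.sum, Prod.fst_sum]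
    rfl
  have h3 : (l.sum fun t c => c • (oneAbove P t, Q t)).2 = l.sum fun t c => c • Q t := by
    rw [Finsupp.sum, Finsupp.sum, Prod.snd_sum]
    rfl
  rw [h2, h3]
  exact hQ.norm_sum_le l

end IsLatticeFamily

/-- A bounded operator on `B_P` is determined by its values at the functions `1_t`. -/
theorem BP_clm_ext {F : Type*} [TopologicalSpace F] [T2Space F] [AddCommMonoid F] [Module ℂ F]
    (hP : IsQuasiLatticeOrdered P) {f g : BP P →L[ℂ] F}
    (h : ∀ t, f ⟨oneAbove P t, oneAbove_mem_BP t⟩ = g ⟨oneAbove P t, oneAbove_mem_BP t⟩) :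
    f = g := by
  refine ContinuousLinearMap.ext_on
    (s := Set.range fun t : P => (⟨oneAbove P t, oneAbove_mem_BP t⟩ : BP P)) ?_ ?_
  · intro a
    rw [closure_subtype]
    have ha : (a : LInfty P) ∈ closure (Submodule.span ℂ (Set.range (oneAbove P)) : Set _) := by
      rw [← coe_BP hP]; exact a.2
    refine closure_mono ?_ ha
    intro y hy
    obtain ⟨l, rfl⟩ := Finsupp.mem_span_range_iff_exists_finsupp.1 hy
    refine ⟨l.sum fun t c => c • ⟨oneAbove P t, oneAbove_mem_BP t⟩, ?_, ?_⟩
    · exact Finsupp.mem_span_range_iff_exists_finsupp.2 ⟨l, rfl⟩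
    · simp only [Finsupp.sum]
      exact map_sum (BP P).subtype _ _
  · rintro _ ⟨t, rfl⟩
    exact h t

end projections

/-! ### Direct sums of representations -/

section directSum

variable {ι : Type*} {H : ι → Type*} [∀ i, NormedAddCommGroup (H i)]
  [∀ i, InnerProductSpace ℂ (H i)]

theorem lp_mapCLM_apply (T : ∀ i, H i →L[ℂ] H i) {K : ℝ} (hK : 0 ≤ K) (hT : ∀ i, ‖T i‖ ≤ K)
    (x : lp H 2) (i : ι) : lp.mapCLM 2 T hK hT x i = T i (x i) := rfl

variable [∀ i, CompleteSpace (H i)]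

theorem star_lp_mapCLM (T S : ∀ i, H i →L[ℂ] H i) {K L : ℝ} (hK : 0 ≤ K) (hT : ∀ i, ‖T i‖ ≤ K)
    (hL : 0 ≤ L) (hS : ∀ i, ‖S i‖ ≤ L) (h : ∀ i, S i = star (T i)) :
    lp.mapCLM 2 S hL hS = star (lp.mapCLM 2 T hK hT) := by
  rw [ContinuousLinearMap.star_eq_adjoint, ContinuousLinearMap.eq_adjoint_iff]
  intro x y
  rw [lp.inner_eq_tsum, lp.inner_eq_tsum]
  refine tsum_congr fun i => ?_
  rw [lp_mapCLM_apply, lp_mapCLM_apply, h, ContinuousLinearMap.star_eq_adjoint,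
    ContinuousLinearMap.adjoint_inner_left]

/-- The direct sum of a family of representations of a C*-algebra. -/
noncomputable def StarAlgHom.directSum {A : Type*} [CStarAlgebra A]
    (π : ∀ i, A →⋆ₐ[ℂ] (H i →L[ℂ] H i)) : A →⋆ₐ[ℂ] (lp H 2 →L[ℂ] lp H 2) where
  toFun a := lp.mapCLM 2 (fun i => π i a) (norm_nonneg a)
    fun i => NonUnitalStarAlgHom.norm_apply_le (π i) a
  map_one' := by ext x i; simp
  map_mul' a b := by ext x i; simp
  map_zero' := by ext x i; simp
  map_add' a b := by ext x i; simp
  commutes' c := by ext x i; simp [Algebra.algebraMap_eq_smul_one]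
  map_star' a := star_lp_mapCLM _ _ _ _ _ _ fun i => map_star (π i) a

theorem StarAlgHom.directSum_apply {A : Type*} [CStarAlgebra A]
    (π : ∀ i, A →⋆ₐ[ℂ] (H i →L[ℂ] H i)) (a : A) (x : lp H 2) (i : ι) :
    StarAlgHom.directSum π a x i = π i a (x i) := rfl

namespace ProductSystem.Rep

variable {P : Type u} [Monoid P] {E : ProductSystem.{u, v} P}

/-- The bound does not depend on `φ`, which makes the direct sum of any family bounded. -/
theorem opNorm_map_le {K : Type*} [NormedAddCommGroup K] [InnerProductSpace ℂ K] [CompleteSpace K]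
    (φ : E.Rep (K →L[ℂ] K)) (z : E.Total) : ‖φ z‖ ≤ ‖z.2‖ :=
  ContinuousLinearMap.opNorm_le_bound _ (norm_nonneg _) fun h => (φ.norm_apply z.2 h).le

/-- The direct sum of a family of representations of a product system. -/
noncomputable def directSum (φ : ∀ i, E.Rep (H i →L[ℂ] H i)) :
    E.Rep (lp H 2 →L[ℂ] lp H 2) where
  toFun z := lp.mapCLM 2 (fun i => φ i z) (norm_nonneg z.2) fun i => (φ i).opNorm_map_le z
  map_mul' y z := by ext x i; simp [(φ i).map_mul']
  star_mul' y z := by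
    rw [← star_lp_mapCLM _ (fun i => star (φ i (E.incl z))) _ _ (norm_nonneg z)
      (fun i => by rw [norm_star]; exact (φ i).opNorm_map_le _) fun i => rfl]
    ext x i
    rw [mul_apply_eq_comp, lp_mapCLM_apply, lp_mapCLM_apply, ← mul_apply_eq_comp, (φ i).star_mul']
    simp

theorem directSum_apply (φ : ∀ i, E.Rep (H i →L[ℂ] H i)) (z : E.Total) (x : lp H 2) (i : ι) :
    directSum φ z x i = φ i z (x i) := rfl

theorem star_directSum_apply (φ : ∀ i, E.Rep (H i →L[ℂ] H i)) (z : E.Total) (x : lp H 2) (i : ι) :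
    star (directSum φ z) x i = star (φ i z) (x i) := by
  have : star (directSum φ z) = lp.mapCLM 2 (fun i => star (φ i z)) (norm_nonneg z.2)
      fun i => by rw [norm_star]; exact (φ i).opNorm_map_le _ :=
    (star_lp_mapCLM _ _ (norm_nonneg z.2) (fun i => (φ i).opNorm_map_le z) _ _ fun i => rfl).symm
  rw [this, lp_mapCLM_apply]

/-- Coordinates are continuous, so the strong sum can be computed in each summand. -/
theorem alpha_directSum_apply (φ : ∀ i, E.Rep (H i →L[ℂ] H i)) (t : P)
    (T : lp H 2 →L[ℂ] lp H 2) (S : ∀ i, H i →L[ℂ] H i) (hT : ∀ x i, T x i = S i (x i))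
    (x : lp H 2) (i : ι) : (directSum φ).alpha t T x i = (φ i).alpha t (S i) (x i) := by
  let b := (exists_hilbertBasis ℂ (E.fibre t)).choose_spec.choose
  have h1 := ((directSum φ).hasSum_alpha b T x).mapL (lp.evalCLM ℂ H 2 i)
  refine h1.unique ?_
  convert (φ i).hasSum_alpha b (S i) (x i) using 2 with j
  change (directSum φ (E.incl (b j)) * T * star (directSum φ (E.incl (b j)))) x i = _
  rw [mul_apply_eq_comp, mul_apply_eq_comp, directSum_apply, hT, star_directSum_apply]
  rfl

end ProductSystem.Rep

theorem IsCovariantPair.directSum {P : Type u} [Monoid P] {E : ProductSystem.{u, v} P}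
    {A : Type*} [CStarAlgebra A] {β : P →* (A →⋆ₙₐ[ℂ] A)} {π : ∀ i, A →⋆ₐ[ℂ] (H i →L[ℂ] H i)}
    {φ : ∀ i, E.Rep (H i →L[ℂ] H i)} (h : ∀ i, IsCovariantPair β E (π i) (φ i)) :
    IsCovariantPair β E (StarAlgHom.directSum π) (ProductSystem.Rep.directSum φ) := by
  intro s a
  ext x i
  rw [StarAlgHom.directSum_apply, h i s a]
  exact (ProductSystem.Rep.alpha_directSum_apply φ s _ (fun i => π i a)
    (StarAlgHom.directSum_apply π a) x i).symm

end directSum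

/-! ### Existence of crossed products -/

section existence

/-- The `*`-polynomial `f` evaluated at a family of elements of a `*`-algebra. -/
noncomputable def starEval {B X : Type*} [Ring B] [StarRing B] [Algebra ℂ B] (x : X → B) :
    FreeAlgebra ℂ (X ⊕ X) →ₐ[ℂ] B :=
  FreeAlgebra.lift ℂ (Sum.elim x fun i => star (x i))

theorem starEval_inl {B X : Type*} [Ring B] [StarRing B] [Algebra ℂ B] (x : X → B) (i : X) :
    starEval x (FreeAlgebra.ι ℂ (Sum.inl i)) = x i := by
  simp [starEval]

theorem starEval_inr {B X : Type*} [Ring B] [StarRing B] [Algebra ℂ B] (x : X → B) (i : X) :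
    starEval x (FreeAlgebra.ι ℂ (Sum.inr i)) = star (x i) := by
  simp [starEval]

/-- This turns the norm hypothesis of `exists_starAlgHom_of_norm_le` into a comparison of two
seminorms on one free algebra. -/
theorem exists_starEval_of_mem_adjoin {A C X : Type*} [CStarAlgebra A] [CStarAlgebra C]
    (x : X → A) (y : X → C) {d : A × C}
    (hd : d ∈ StarAlgebra.adjoin ℂ (Set.range fun i => (x i, y i))) :
    ∃ f, d = (starEval x f, starEval y f) := by
  have h1 : (Set.range fun i => (x i, y i)) ∪ star (Set.range fun i => (x i, y i))
      = Set.range (Sum.elim (fun i => (x i, y i)) fun i => star (x i, y i)) := by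
    rw [Set.Sum.elim_range]
    congr 1
    ext z
    rw [Set.mem_star]
    constructor
    · rintro ⟨i, hi⟩
      exact ⟨i, by rw [← star_star z, ← hi]⟩
    · rintro ⟨i, rfl⟩
      exact ⟨i, (star_star _).symm⟩
  rw [← StarSubalgebra.mem_toSubalgebra, StarAlgebra.adjoin_toSubalgebra, h1,
    Algebra.adjoin_range_eq_range_freeAlgebra_lift] at hd
  obtain ⟨f, rfl⟩ := hd
  have h2 : (AlgHom.fst ℂ A C).comp (starEval fun i => (x i, y i)) = starEval x := by
    ext (i | i) <;> simp [starEval]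
  have h3 : (AlgHom.snd ℂ A C).comp (starEval fun i => (x i, y i)) = starEval y := by
    ext (i | i) <;> simp [starEval]
  refine ⟨f, Prod.ext ?_ ?_⟩
  · exact congrArg (fun g => g f) h2
  · exact congrArg (fun g => g f) h3

variable {P : Type u} [Monoid P] {A : Type u} [CStarAlgebra A]

/-- A covariant representation of a twisted system on some Hilbert space. -/
structure CovariantPair (β : P →* (A →⋆ₙₐ[ℂ] A)) (E : ProductSystem.{u, u} P) where
  space : Type u
  [normed : NormedAddCommGroup space]
  [innerProduct : InnerProductSpace ℂ space]
  [complete : CompleteSpace space]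
  algebraRep : A →⋆ₐ[ℂ] (space →L[ℂ] space)
  systemRep : E.Rep (space →L[ℂ] space)
  covariant : IsCovariantPair β E algebraRep systemRep

namespace CovariantPair

attribute [instance] CovariantPair.normed CovariantPair.innerProduct CovariantPair.complete

variable {β : P →* (A →⋆ₙₐ[ℂ] A)} {E : ProductSystem.{u, u} P}

/-- The operators of a covariant representation. -/
noncomputable def gen (p : CovariantPair β E) : A ⊕ E.Total → (p.space →L[ℂ] p.space) :=
  Sum.elim p.algebraRep p.systemRep

/-- The seminorm of a covariant representation on `*`-polynomials. -/
noncomputable def seminorm (p : CovariantPair β E)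
    (f : FreeAlgebra ℂ ((A ⊕ E.Total) ⊕ (A ⊕ E.Total))) : ℝ :=
  ‖starEval p.gen f‖

/-- The direct sum of a family of covariant representations. -/
noncomputable def directSum {ι : Type u} (p : ι → CovariantPair β E) : CovariantPair β E where
  space := lp (fun i => (p i).space) 2
  algebraRep := StarAlgHom.directSum fun i => (p i).algebraRep
  systemRep := ProductSystem.Rep.directSum fun i => (p i).systemRep
  covariant := IsCovariantPair.directSum fun i => (p i).covariant

/-- The components of a vector in a direct sum. -/
def coord {ι : Type u} (p : ι → CovariantPair β E) (i : ι) (x : (directSum p).space) :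
    (p i).space :=
  let y : lp (fun i => (p i).space) 2 := x
  y i

theorem coord_starEval {ι : Type u} (p : ι → CovariantPair β E) (i : ι)
    (f : FreeAlgebra ℂ ((A ⊕ E.Total) ⊕ (A ⊕ E.Total))) (x : (directSum p).space) :
    coord p i (starEval (directSum p).gen f x) = starEval (p i).gen f (coord p i x) := by
  induction f using FreeAlgebra.induction generalizing x with
  | grade0 r =>
    rw [AlgHom.commutes, AlgHom.commutes, Algebra.algebraMap_eq_smul_one,
      Algebra.algebraMap_eq_smul_one]
    rfl
  | grade1 g =>
    rcases g with g | g
    · rw [starEval_inl, starEval_inl]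
      rcases g with a | z <;> rfl
    · rw [starEval_inr, starEval_inr]
      rcases g with a | z
      · change coord p i (star ((directSum p).algebraRep a) x)
          = star ((p i).algebraRep a) (coord p i x)
        rw [← map_star, ← map_star]
        rfl
      · exact ProductSystem.Rep.star_directSum_apply (fun i => (p i).systemRep) z x i
  | mul f g hf hg =>
    rw [map_mul, map_mul, mul_apply_eq_comp, mul_apply_eq_comp, ← hg, ← hf]
  | add f g hf hg =>
    rw [map_add, map_add, add_apply, add_apply, ← hf, ← hg]
    rfl

/-- A vector of the summand, placed in the direct sum with zeros elsewhere, keeps its norm. -/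
theorem seminorm_le_directSum {ι : Type u} (p : ι → CovariantPair β E) (i : ι)
    (f : FreeAlgebra ℂ ((A ⊕ E.Total) ⊕ (A ⊕ E.Total))) :
    (p i).seminorm f ≤ (directSum p).seminorm f := by
  classical
  refine ContinuousLinearMap.opNorm_le_bound _ (norm_nonneg _) fun h => ?_
  let y : lp (fun i => (p i).space) 2 := lp.single 2 i h
  let x : (directSum p).space := y
  have hx : coord p i x = h := lp.single_apply_self (E := fun i => (p i).space) 2 i h
  have hn : ‖x‖ = ‖h‖ := lp.norm_single (E := fun i => (p i).space) (by norm_num) i h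
  rw [← hx, ← coord_starEval, hx, ← hn]
  refine le_trans ?_ (ContinuousLinearMap.le_opNorm (starEval (directSum p).gen f) x)
  exact lp.norm_apply_le_norm (E := fun i => (p i).space) (by norm_num) _ i

variable (β E)

/-- A covariant representation which dominates all others: the direct sum of one covariant
representation for each of the seminorms that they define. -/
noncomputable def universal : CovariantPair β E :=
  -- The pairs themselves live one universe too high to index a direct sum; their seminorms are real
  -- functions on a fixed algebra in `Type u`.
  directSum fun i : Set.range (seminorm (β := β) (E := E)) => i.2.choose

variable {β E}

theorem seminorm_le_universal (p : CovariantPair β E)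
    (f : FreeAlgebra ℂ ((A ⊕ E.Total) ⊕ (A ⊕ E.Total))) :
    p.seminorm f ≤ (universal β E).seminorm f := by
  let i : Set.range (seminorm (β := β) (E := E)) := ⟨p.seminorm, p, rfl⟩
  have h : i.2.choose.seminorm = p.seminorm := i.2.choose_spec
  rw [← h]
  exact seminorm_le_directSum (fun i : Set.range (seminorm (β := β) (E := E)) => i.2.choose) i f

end CovariantPair

/-- Every twisted system has a crossed product. -/
theorem exists_isCrossedProduct (β : P →* (A →⋆ₙₐ[ℂ] A)) (E : ProductSystem.{u, u} P) :
    ∃ (B : Type u) (_ : CStarAlgebra B) (iA : A →⋆ₐ[ℂ] B) (iE : E.Rep B),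
      IsCrossedProduct β E iA iE := by
  let p := CovariantPair.universal β E
  let S : Set (p.space →L[ℂ] p.space) := Set.range p.gen
  have hA : ∀ a, p.algebraRep a ∈ generatedBy S := fun a => subset_generatedBy S ⟨Sum.inl a, rfl⟩
  have hE : ∀ z, p.systemRep z ∈ generatedBy S := fun z => subset_generatedBy S ⟨Sum.inr z, rfl⟩
  refine ⟨generatedBy S, inferInstance, p.algebraRep.codRestrict _ hA,
    p.systemRep.codRestrict _ hE, ?_, ?_, ?_⟩
  · exact ⟨p.space, inferInstance, inferInstance, inferInstance, (generatedBy S).subtype,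
      Subtype.val_injective, p.covariant⟩
  · intro H _ _ _ π φ h
    let q : CovariantPair β E := ⟨H, π, φ, h⟩
    obtain ⟨ρ, hρ⟩ := exists_starAlgHom_of_norm_le p.gen q.gen fun d hd => by
      obtain ⟨f, rfl⟩ := exists_starEval_of_mem_adjoin _ _ hd
      exact q.seminorm_le_universal f
    exact ⟨ρ, fun a => hρ (Sum.inl a), fun z => hρ (Sum.inr z)⟩
  · rw [← generatedBy_preimage_eq_top S]
    congr 1
    ext b
    constructor
    · rintro (⟨a, rfl⟩ | ⟨z, rfl⟩)
      · exact ⟨Sum.inl a, rfl⟩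
      · exact ⟨Sum.inr z, rfl⟩
    · rintro ⟨a | z, h⟩
      · exact Or.inl ⟨a, Subtype.ext h⟩
      · exact Or.inr ⟨z, Subtype.ext h⟩

end existence

/-! ### Covariance -/

section covariance

variable {G : Type u} [Group G] {P : Submonoid G} {E : ProductSystem.{u, v} P}

theorem translationAction_one (s : P) :
    translationAction P s 1 = ⟨oneAbove P s, oneAbove_mem_BP s⟩ := by
  refine Subtype.ext ?_
  have h := leftTranslate_oneAbove P s 1
  rw [oneAbove_one, mul_one] at h
  exact h

theorem translationAction_oneAbove (s t : P) :
    translationAction P s ⟨oneAbove P t, oneAbove_mem_BP t⟩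
      = ⟨oneAbove P (s * t), oneAbove_mem_BP (s * t)⟩ :=
  Subtype.ext (leftTranslate_oneAbove P s t)

variable {H : Type w} [NormedAddCommGroup H] [InnerProductSpace ℂ H] [CompleteSpace H]

theorem IsCovariantPair.alpha_one {π : BP P →⋆ₐ[ℂ] (H →L[ℂ] H)} {φ : E.Rep (H →L[ℂ] H)}
    (h : IsCovariantPair (translationAction P) E π φ) (t : P) :
    φ.alpha t 1 = π ⟨oneAbove P t, oneAbove_mem_BP t⟩ := by
  rw [← translationAction_one, h t 1, map_one]

theorem IsLatticeFamily.map {A C : Type*} [CStarAlgebra A] [CStarAlgebra C] {Q : P → A}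
    (hQ : IsLatticeFamily Q) (π : A →⋆ₐ[ℂ] C) : IsLatticeFamily fun t => π (Q t) where
  map_one := by rw [hQ.map_one, _root_.map_one]
  star_eq t := by rw [← map_star, hQ.star_eq]
  mul_eq s t m h := by rw [← map_mul, hQ.mul_eq s t m h]
  mul_eq_zero s t h := by rw [← map_mul, hQ.mul_eq_zero s t h, map_zero]

theorem isLatticeFamily_oneAbove_BP (hP : IsQuasiLatticeOrdered P) :
    IsLatticeFamily fun t : P => (⟨oneAbove P t, oneAbove_mem_BP t⟩ : BP P) where
  map_one := Subtype.ext (oneAbove_one P)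
  star_eq t := Subtype.ext (star_oneAbove t)
  mul_eq s t m h := Subtype.ext ((isLatticeFamily_oneAbove hP).mul_eq s t m h)
  mul_eq_zero s t h := Subtype.ext ((isLatticeFamily_oneAbove hP).mul_eq_zero s t h)

theorem IsCovariantPair.isCovariant (hP : IsQuasiLatticeOrdered P)
    {π : BP P →⋆ₐ[ℂ] (H →L[ℂ] H)} {φ : E.Rep (H →L[ℂ] H)}
    (h : IsCovariantPair (translationAction P) E π φ) : φ.IsCovariant := by
  have hQ := (isLatticeFamily_oneAbove_BP hP).map π
  intro s t
  simp only [h.alpha_one]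
  exact ⟨fun m hm => hQ.mul_eq s t m hm, hQ.mul_eq_zero s t⟩

theorem ProductSystem.Rep.IsCovariant.isLatticeFamily {φ : E.Rep (H →L[ℂ] H)}
    (h : φ.IsCovariant) : IsLatticeFamily fun t => φ.alpha t 1 where
  map_one := φ.alpha_one_one
  star_eq := φ.star_alpha_one
  mul_eq s t := (h s t).1
  mul_eq_zero s t := (h s t).2

/-- A covariant representation of `E` comes with a representation of `B_P`. -/
theorem ProductSystem.Rep.IsCovariant.exists_isCovariantPair (hP : IsQuasiLatticeOrdered P)
    {φ : E.Rep (H →L[ℂ] H)} (h : φ.IsCovariant) :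
    ∃ π : BP P →⋆ₐ[ℂ] (H →L[ℂ] H), IsCovariantPair (translationAction P) E π φ := by
  obtain ⟨π, hπ⟩ := h.isLatticeFamily.exists_starAlgHom hP
  refine ⟨π, fun s => ?_⟩
  let toCLM (ψ : BP P →⋆ₙₐ[ℂ] BP P) : BP P →L[ℂ] BP P :=
    LinearMap.mkContinuous
      { toFun := ψ, map_add' := map_add ψ, map_smul' := map_smul ψ } 1
      fun a => by simpa using NonUnitalStarAlgHom.norm_apply_le ψ a
  let π' : BP P →L[ℂ] (H →L[ℂ] H) :=
    LinearMap.mkContinuous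
      { toFun := π, map_add' := map_add π, map_smul' := map_smul π } 1
      fun a => by simpa using NonUnitalStarAlgHom.norm_apply_le π a
  -- On `1_t` both sides are `α_{st}(1)`, and the `1_t` span a dense subspace.
  have key : π' ∘L toCLM (translationAction P s) = φ.alphaCLM s ∘L π' := by
    refine BP_clm_ext hP fun t => ?_
    change π (translationAction P s _) = φ.alpha s (π _)
    rw [translationAction_oneAbove, hπ, hπ, φ.alpha_mul]
  exact fun a => congrArg (fun T => T a) key

end covariance

/-! ### Finite-dimensional fibres -/

section finiteDimensional

namespace ProductSystem

theorem span_mul_eq_top {P : Type u} [Monoid P] (E : ProductSystem.{u, v} P) (s t : P)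
    [FiniteDimensional ℂ (E.fibre (s * t))] :
    Submodule.span ℂ {w : E.fibre (s * t) | ∃ (x : E.fibre s) (y : E.fibre t),
      w = E.mul x y} = ⊤ := by
  have h := (E.dense_span_mul s t).closure_eq
  rw [(Submodule.closed_of_finiteDimensional _).closure_eq] at h
  exact SetLike.coe_injective h

namespace Rep

section linear

variable {P : Type u} [Monoid P] {E : ProductSystem.{u, v} P} {B : Type w} [CStarAlgebra B]

/-- A representation is linear on the fibres. -/
noncomputable def linearMap (φ : E.Rep B) (t : P) : E.fibre t →ₗ[ℂ] B :=
  have h : ∀ (c : ℂ) (x y : E.fibre t),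
      φ (E.incl (c • x + y)) = c • φ (E.incl x) + φ (E.incl y) := fun c x y => by
    rw [← sub_eq_zero, ← CStarRing.star_mul_self_eq_zero_iff]
    simp only [star_sub, star_add, star_smul, sub_mul, mul_sub, add_mul, mul_add,
      smul_mul_assoc, mul_smul_comm, φ.star_mul', inner_add_left, inner_add_right, inner_smul_left,
      inner_smul_right, smul_smul, add_smul, starRingEnd_apply, smul_add]
    module
  have h0 : φ (E.incl (0 : E.fibre t)) = 0 := by
    rw [← CStarRing.star_mul_self_eq_zero_iff, φ.star_mul', inner_zero_left, zero_smul]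
  { toFun := fun x => φ (E.incl x)
    map_add' := fun x y => by simpa using h 1 x y
    map_smul' := fun c x => by simpa [h0] using h c x 0 }

theorem linearMap_apply (φ : E.Rep B) {t : P} (x : E.fibre t) :
    φ.linearMap t x = φ (E.incl x) := rfl

/-- The fibre over `m` is spanned by products `xy`, and `φ(z)^* φ(xy) = ⟨x, z⟩ φ(y)`. Keeping `m`
apart from `s * p` lets one `m` be factored in two ways. -/
theorem exists_star_mul_eq (φ : E.Rep B) {s p m : P} (hm : s * p = m)
    [FiniteDimensional ℂ (E.fibre m)] (z : E.fibre s) (w : E.fibre m) :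
    ∃ f : E.fibre p, star (φ (E.incl z)) * φ (E.incl w) = φ (E.incl f) := by
  subst hm
  have hw : w ∈ Submodule.span ℂ {w : E.fibre (s * p) | ∃ (x : E.fibre s) (y : E.fibre p),
      w = E.mul x y} := by rw [E.span_mul_eq_top]; trivial
  simp only [← φ.linearMap_apply]
  induction hw using Submodule.span_induction with
  | mem w hw =>
    obtain ⟨x, y, rfl⟩ := hw
    refine ⟨inner ℂ z x • y, ?_⟩
    rw [map_smul, linearMap_apply, linearMap_apply, linearMap_apply, map_incl_mul, ← mul_assoc,
      φ.star_mul', smul_mul_assoc, one_mul]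
  | zero => exact ⟨0, by simp⟩
  | add x y _ _ hx hy =>
    obtain ⟨f, hf⟩ := hx
    obtain ⟨g, hg⟩ := hy
    exact ⟨f + g, by rw [map_add, mul_add, hf, hg, map_add]⟩
  | smul c x _ hx =>
    obtain ⟨f, hf⟩ := hx
    exact ⟨c • f, by rw [map_smul, mul_smul_comm, hf, map_smul]⟩

/-- The span of the elements `φ(u) φ(v)^*`. -/
noncomputable def wordSpan (φ : E.Rep B) : Submodule ℂ B :=
  Submodule.span ℂ {b : B | ∃ y z : E.Total, b = φ y * star (φ z)}

theorem mul_star_mem_wordSpan (φ : E.Rep B) (y z : E.Total) : φ y * star (φ z) ∈ φ.wordSpan :=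
  Submodule.subset_span ⟨y, z, rfl⟩

theorem mul_mul_star_mem_wordSpan (φ : E.Rep B) (y z : E.Total) {b : B} (hb : b ∈ φ.wordSpan) :
    φ y * b * star (φ z) ∈ φ.wordSpan := by
  induction hb using Submodule.span_induction with
  | mem b hb =>
    obtain ⟨f, g, rfl⟩ := hb
    have : φ y * (φ f * star (φ g)) * star (φ z) = φ (y * f) * star (φ (z * g)) := by
      rw [φ.map_mul', φ.map_mul', star_mul]
      simp only [mul_assoc]
    rw [this]
    exact φ.mul_star_mem_wordSpan _ _
  | zero => simp
  | add a b _ _ ha hb => rw [mul_add, add_mul]; exact Submodule.add_mem _ ha hb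
  | smul c b _ hb => rw [mul_smul_comm, smul_mul_assoc]; exact Submodule.smul_mem _ c hb

end linear

variable {G : Type u} [Group G] {P : Submonoid G} {E : ProductSystem.{u, v} P}
  {B : Type w} [CStarAlgebra B]

/-- `Q` is the family of the projections `∑ φ(u) φ(u)^*`, for a representation with
finite-dimensional fibres. -/
def IsRangeFamily (φ : E.Rep B) (Q : P → B) : Prop :=
  ∀ (t : P) (n : ℕ) (b : OrthonormalBasis (Fin n) ℂ (E.fibre t)),
    Q t = ∑ i, φ (E.incl (b i)) * star (φ (E.incl (b i)))

namespace IsRangeFamily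

variable {φ : E.Rep B} {Q : P → B} [∀ t, FiniteDimensional ℂ (E.fibre t)]

theorem mem_wordSpan (hφ : φ.IsRangeFamily Q) (t : P) : Q t ∈ φ.wordSpan := by
  rw [hφ t _ (stdOrthonormalBasis ℂ (E.fibre t))]
  exact Submodule.sum_mem _ fun i _ => φ.mul_star_mem_wordSpan _ _

theorem mul_map (hφ : φ.IsRangeFamily Q) {t : P} (y : E.fibre t) :
    Q t * φ (E.incl y) = φ (E.incl y) := by
  let b := stdOrthonormalBasis ℂ (E.fibre t)
  rw [hφ t _ b, Finset.sum_mul]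
  simp only [mul_assoc, φ.star_mul', mul_smul_comm, mul_one]
  conv_rhs => rw [← b.sum_repr' y, ← linearMap_apply, map_sum]
  simp only [map_smul, linearMap_apply]

/-- Since `φ(z)^* = φ(z)^* Q_s` and `φ(y) = Q_t φ(y)`, the product `Q_s Q_t` may be inserted. It is
0 or `∑ φ(w) φ(w)^*` over a basis of the fibre at `m = s ∨ t`; then `φ(z)^* φ(w)` and `φ(w)^* φ(y)`
reduce to some `φ(f)` and `φ(g)^*`. -/
theorem star_mul_mem_wordSpan (hφ : φ.IsRangeFamily Q) (hQ : IsLatticeFamily Q) {s t : P}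
    (z : E.fibre s) (y : E.fibre t) : star (φ (E.incl z)) * φ (E.incl y) ∈ φ.wordSpan := by
  have h1 : star (φ (E.incl z)) * φ (E.incl y)
      = star (φ (E.incl z)) * (Q s * Q t) * φ (E.incl y) := by
    have h2 := congrArg star (hφ.mul_map z)
    rw [star_mul, hQ.star_eq] at h2
    rw [← mul_assoc, h2, mul_assoc, hφ.mul_map]
  rw [h1]
  by_cases h : ∃ m : G, IsLeastUpperBoundIn P {(s : G), (t : G)} m
  · obtain ⟨m, hm⟩ := h
    let m' : P := ⟨m, hm.1.1⟩
    let p : P := ⟨(s : G)⁻¹ * m, hm.1.2 _ (Or.inl rfl)⟩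
    let q : P := ⟨(t : G)⁻¹ * m, hm.1.2 _ (Or.inr rfl)⟩
    have hp : s * p = m' := Subtype.ext (mul_inv_cancel_left _ _)
    have hq : t * q = m' := Subtype.ext (mul_inv_cancel_left _ _)
    rw [hQ.mul_eq s t m' hm, hφ m' _ (stdOrthonormalBasis ℂ (E.fibre m')), Finset.mul_sum,
      Finset.sum_mul]
    refine Submodule.sum_mem _ fun i _ => ?_
    obtain ⟨f, hf⟩ := φ.exists_star_mul_eq hp z (stdOrthonormalBasis ℂ (E.fibre m') i)
    obtain ⟨g, hg⟩ := φ.exists_star_mul_eq hq y (stdOrthonormalBasis ℂ (E.fibre m') i)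
    have hg' := congrArg star hg
    rw [star_mul, star_star] at hg'
    rw [← mul_assoc, hf, mul_assoc, hg']
    exact φ.mul_star_mem_wordSpan _ _
  · rw [hQ.mul_eq_zero s t h, mul_zero, zero_mul]
    exact Submodule.zero_mem _

theorem adjoin_le_wordSpan (hφ : φ.IsRangeFamily Q) (hQ : IsLatticeFamily Q) :
    (StarAlgebra.adjoin ℂ (Set.range φ) : Set B) ⊆ φ.wordSpan := by
  have h1 : (1 : B) ∈ φ.wordSpan := hQ.map_one ▸ hφ.mem_wordSpan 1
  have h2 : (StarAlgebra.adjoin ℂ {b : B | ∃ y z : E.Total, b = φ y * star (φ z)} : Set B)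
      ⊆ φ.wordSpan := by
    refine adjoin_le_span h1 ?_ ?_
    · rintro _ ⟨y, z, rfl⟩
      rw [star_mul, star_star]
      exact φ.mul_star_mem_wordSpan _ _
    · rintro _ ⟨y, z, rfl⟩ _ ⟨y', z', rfl⟩
      have h3 : φ y * star (φ z) * (φ y' * star (φ z'))
          = φ y * (star (φ z) * φ y') * star (φ z') := by simp only [mul_assoc]
      rw [h3]
      exact φ.mul_mul_star_mem_wordSpan _ _ (hφ.star_mul_mem_wordSpan hQ z.2 y'.2)
  refine subset_trans (StarAlgebra.adjoin_le ?_) h2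
  rintro _ ⟨y, rfl⟩
  -- A single `φ(y)` becomes a sum of words by multiplying on the right with `1 = Q 1`.
  have h4 : φ y = ∑ i, φ (y * E.incl (stdOrthonormalBasis ℂ (E.fibre 1) i))
      * star (φ (E.incl (stdOrthonormalBasis ℂ (E.fibre 1) i))) := by
    conv_lhs => rw [← mul_one (φ y), ← hQ.map_one, hφ 1 _ (stdOrthonormalBasis ℂ (E.fibre 1)),
      Finset.mul_sum]
    simp only [φ.map_mul', mul_assoc]
  rw [h4]
  exact sum_mem fun i _ => StarAlgebra.subset_adjoin ℂ _ ⟨_, _, rfl⟩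

end IsRangeFamily

end Rep

end ProductSystem

/-- In a faithful covariant representation `1_t` acts as `α_t(1)`, here a finite sum; faithfulness
brings the identity back to `B`. -/
theorem IsCrossedProduct.isRangeFamily {G : Type u} [Group G] {P : Submonoid G}
    {E : ProductSystem.{u, v} P} {B : Type w} [CStarAlgebra B] {iB : BP P →⋆ₐ[ℂ] B} {iE : E.Rep B}
    (h : IsCrossedProduct (translationAction P) E iB iE) :
    iE.IsRangeFamily fun t => iB ⟨oneAbove P t, oneAbove_mem_BP t⟩ := by
  intro t n b
  obtain ⟨H, _, _, _, σ, hσ, hc⟩ := h.exists_faithful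
  refine hσ ?_
  have h1 := hc.alpha_one t
  change _ = σ (iB _) at h1
  rw [← h1]
  ext x
  refine ((iE.comp σ).hasSum_alpha b.toHilbertBasis 1 x).unique ?_
  convert hasSum_fintype _
  rw [map_sum, sum_apply]
  refine Finset.sum_congr rfl fun i _ => ?_
  rw [map_mul, map_star, mul_one, OrthonormalBasis.coe_toHilbertBasis]
  rfl

/-- The images of the `1_t` are finite sums of elements `i_E(u) i_E(u)^*`, and continuity of `iB`
puts the image of all of `B_P` in the closed algebra generated by `iE`. -/
theorem IsCrossedProduct.generatedAlgebra_eq_top {G : Type u} [Group G] {P : Submonoid G}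
    {E : ProductSystem.{u, v} P} {B : Type w} [CStarAlgebra B] {iB : BP P →⋆ₐ[ℂ] B} {iE : E.Rep B}
    [∀ t, FiniteDimensional ℂ (E.fibre t)]
    (h : IsCrossedProduct (translationAction P) E iB iE) : iE.generatedAlgebra = ⊤ := by
  have hclosed : IsClosed (iE.generatedAlgebra : Set B) := isClosed_generatedBy _
  have hmem : ∀ z, iE z ∈ iE.generatedAlgebra := fun z => subset_generatedBy _ ⟨z, rfl⟩
  refine eq_top_iff.2 (h.generated ▸ generatedBy_le hclosed ?_)
  rintro _ (⟨a, rfl⟩ | ⟨z, rfl⟩)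
  · have hc : Continuous iB :=
      AddMonoidHomClass.continuous_of_bound iB 1 fun a => by
        simpa using NonUnitalStarAlgHom.norm_apply_le iB a
    have h2 : generatedBy ((↑) ⁻¹' Set.range (oneAbove P) : Set (BP P))
        ≤ iE.generatedAlgebra.comap iB := by
      refine generatedBy_le (hclosed.preimage hc) ?_
      rintro ⟨_, _⟩ ⟨t, rfl⟩
      change iB ⟨oneAbove P t, oneAbove_mem_BP t⟩ ∈ iE.generatedAlgebra
      have hr := h.isRangeFamily t _ (stdOrthonormalBasis ℂ (E.fibre t))
      dsimp only at hr
      rw [hr]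
      exact sum_mem fun i _ => mul_mem (hmem _) (star_mem (hmem _))
    have h3 : generatedBy ((↑) ⁻¹' Set.range (oneAbove P) : Set (BP P)) = ⊤ :=
      generatedBy_preimage_eq_top (Set.range (oneAbove P))
    exact h2 (h3 ▸ StarSubalgebra.mem_top)
  · exact hmem z

end finiteDimensional

theorem mainTheorem4 {G : Type u} [Group G] (P : Submonoid G) (hP : IsQuasiLatticeOrdered P)
    (E : ProductSystem.{u, u} P) :
    (∃ (B : Type u) (_ : CStarAlgebra B) (iB : BP P →⋆ₐ[ℂ] B) (iE : E.Rep B),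
      IsCrossedProduct (translationAction P) E iB iE) ∧
    ∀ (B : Type u) [CStarAlgebra B] (iB : BP P →⋆ₐ[ℂ] B) (iE : E.Rep B),
      IsCrossedProduct (translationAction P) E iB iE →
      (∃ (H : Type u) (_ : NormedAddCommGroup H) (_ : InnerProductSpace ℂ H)
        (_ : CompleteSpace H) (σ : iE.generatedAlgebra →⋆ₐ[ℂ] (H →L[ℂ] H)),
        Function.Injective σ ∧ (iE.toGenerated.comp σ).IsCovariant) ∧
      (∀ (H : Type u) [NormedAddCommGroup H] [InnerProductSpace ℂ H] [CompleteSpace H]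
        (φ : E.Rep (H →L[ℂ] H)), φ.IsCovariant →
        ∃ π : iE.generatedAlgebra →⋆ₐ[ℂ] (H →L[ℂ] H), ∀ z, φ z = π (iE.toGenerated z)) ∧
      ((∀ t, FiniteDimensional ℂ (E.fibre t)) →
        iE.generatedAlgebra = ⊤ ∧
        closure (Submodule.span ℂ {b : B | ∃ y z : E.Total, b = iE y * star (iE z)} : Set B)
          = Set.univ) := by
  refine ⟨exists_isCrossedProduct _ E, fun B _ iB iE h => ⟨?_, ?_, ?_⟩⟩
  · obtain ⟨H, i1, i2, i3, σ, hσ, hc⟩ := h.exists_faithful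
    exact ⟨H, i1, i2, i3, σ.comp iE.generatedAlgebra.subtype,
      hσ.comp Subtype.val_injective, hc.isCovariant hP⟩
  · intro H _ _ _ φ hφ
    obtain ⟨π, hπ⟩ := hφ.exists_isCovariantPair hP
    obtain ⟨ρ, -, hρ⟩ := h.exists_lift H π φ hπ
    exact ⟨ρ.comp iE.generatedAlgebra.subtype, fun z => (hρ z).symm⟩
  · intro _
    have htop := h.generatedAlgebra_eq_top
    refine ⟨htop, Set.eq_univ_of_forall fun b => ?_⟩
    have hb : b ∈ iE.generatedAlgebra := htop ▸ StarSubalgebra.mem_top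
    exact closure_mono (h.isRangeFamily.adjoin_le_wordSpan
      ((isLatticeFamily_oneAbove_BP hP).map iB)) hb
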